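/- **Model.** Time is divided into slots (late arrival, delayed access: arrivals of a slot occur in $(t-,t)$, departures in $(t,t+)$). In each slot, independently, a group of customers arrives with probability $\lambda$, $0<\lambda\le 1$ ($\bar\lambda=1-\lambda$); its size is $i\ge 1$ with probability $g_i$, and $G(z)=\sum_{i\ge1}g_iz^i$. Let $1\le a\le b$ be integers and $0<p<1$. A single server gives every customer a first essential service (FES) in batches: from a queue of $n\ge a$ customers it takes a batch of $\min(n,b)$ customers. The FES of a batch of size $r$ ($a\le r\le b$) lasts a random number $\ge 1$ of slots with $z$-transform $S_r^*$. When it ends, $y$ of the $r$ customers, with probability $\chi_{r,y}=\binom ry p^y(1-p)^{r-y}$, require a second optional service (SOS), which, if $y\ge1$, starts at once, is given to them as one batch, and lasts a random number $\ge1$ of slots with $z$-transform $S_y^{*O}$. When a batch has left (at the end of the FES if $y=0$, at the end of the SOS otherwise) with $n$ customers in the queue, the next FES starts if $n\ge a$; if $n<a$, the server starts a vacation of type $n$. A vacation of type $k$ ($0\le k\le a-1$) lasts a random number $\ge1$ of slots with $z$-transform $V^{[k]*}$. When a vacation ends with $n$ customers in the queue, an FES starts if $n\ge a$; if $n<a$,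 then under the multiple vacation policy ($\delta_p=1$) a vacation of type $n$ starts, and under the single vacation policy ($\delta_p=0$) the server stays dormant until at least $a$ customers are in the queue, and then starts an FES. All durations, group sizes and choices are independent. **Steady state.** The state at $t-$ consists of the queue length, the activity of the server (dormant; FES of $r$ customers; SOS of $j$ customers; vacation of type $k$) and the remaining number of slots of this activity. Assume that, for some initial distribution, the distribution of the state at $t-$ converges pointwise as $t\to\infty$ to a probability distribution $\pi$, the steady state. With $\pi$ as the law of the state at $t-$, let $\alpha^+_{n,r}$, $\beta^+_{n,j}$, $\gamma_n^{[k]+}$ be the conditional probabilities, given that a service or a vacation is completed in $(t,t+)$, that at this completion there are $n$ customers in the queue and that what was completed is, respectively, an FES of $r$ customers, an SOS of $j$ customers, a vacation of type $k$. **Notation.** $K^r(z)=S_r^*(\bar\lambda+\lambda G(z))$, $T^y(z)=S_y^{*O}(\bar\lambda+\lambda G(z))$, $H_k(z)=V^{[k]*}(\bar\lambda+\lambda G(z))$; $$F_i(z_1,z_2)=\sum_{y=1}^{a+i-1}\chi_{a+i-1,y}\,z_2^y\,T^y(z_1)\quad(1\le i\le b-a+1),\qquad Q_n(z_1)=\chi_{n,0}+F_{n-a+1}(z_1,1)\quad(a\le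 n\le b);$$ $e_{n,n}=1$ and $e_{n,i}=\sum_{j=i+1}^{n-1}e_{n,j}g_{j-i}+g_{n-i}$ for $0\le i<n$; $$A_n=\sum_{\ell=a}^b\alpha^+_{n,\ell}\chi_{\ell,0}+\sum_{j=1}^b\beta^+_{n,j},\qquad \Gamma_n=\sum_{k=0}^{a-1}\gamma_n^{[k]+},\qquad D_n=(1-\delta_p)\sum_{\ell=0}^{a-1}\sum_{k=0}^{\ell}\gamma_\ell^{[k]+}\sum_{j=\ell}^{a-1}e_{j,\ell}\,g_{n-j}\quad(n\ge a).$$ **Theorem.** In steady state the probability that a service or a vacation is completed in a slot is positive. For all complex $z_1,z_2$ with $|z_1|\le1$, $|z_2|\le1$ the series $$\Pi^+(z_1,z_2)=\sum_{n=0}^\infty\sum_{r=a}^b\alpha^+_{n,r}z_1^nz_2^r,\qquad \Delta^+(z_1,z_2)=\sum_{n=0}^\infty\sum_{y=1}^b\beta^+_{n,y}z_1^nz_2^y$$ converge absolutely, and, with the common denominator $$\mathcal D(z_1)=z_1^b-\big(\chi_{b,0}+F_{b-a+1}(z_1,1)\big)K^b(z_1),$$ one has $\Pi^+(z_1,z_2)\,\mathcal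 D(z_1)=N_\Pi(z_1,z_2)$ and $\Delta^+(z_1,z_2)\,\mathcal D(z_1)=N_\Delta(z_1,z_2)$; hence, wherever $\mathcal D(z_1)\ne0$, $$\Pi^+(z_1,z_2)=\frac{N_\Pi(z_1,z_2)}{\mathcal D(z_1)},\qquad \Delta^+(z_1,z_2)=\frac{N_\Delta(z_1,z_2)}{\mathcal D(z_1)},$$ where $$\begin{aligned}N_\Pi(z_1,z_2)=&\sum_{n=0}^{a-1}\Big[(1-\delta_p)\sum_{k=0}^n\gamma_n^{[k]+}\sum_{j=n}^{a-1}e_{j,n}\Big(\sum_{i=a}^bg_{i-j}K^i(z_1)z_2^iz_1^b+\sum_{i=b+1-j}^\infty g_iz_1^{i+j}K^b(z_1)z_2^b\\&\qquad-\sum_{i=a}^{b-1}g_{i-j}K^i(z_1)z_2^i\,Q_b(z_1)K^b(z_1)\Big)+(A_n+\delta_p\Gamma_n)z_1^nH_n(z_1)K^b(z_1)z_2^b-(A_n+\Gamma_n)z_1^nK^b(z_1)z_2^b\Big]\\&+\sum_{n=a}^{b-1}\Big[(A_n+\Gamma_n)z_2^nK^n(z_1)\mathcal D(z_1)+K^b(z_1)z_2^b\Big\{K^n(z_1)(A_n+\Gamma_n+D_n)Q_n(z_1)-(A_n+\Gamma_n)z_1^n\Big\}\Big],\end{aligned}$$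 $$\begin{aligned}N_\Delta(z_1,z_2)=&\sum_{n=0}^{a-1}F_{b-a+1}(z_1,z_2)K^b(z_1)\Big[(1-\delta_p)\sum_{k=0}^n\gamma_n^{[k]+}\sum_{j=n}^{a-1}e_{j,n}\Big(g_{b-j}z_1^b+\sum_{i=b+1-j}^\infty g_iz_1^{i+j}\Big)\\&\qquad+(A_n+\delta_p\Gamma_n)z_1^nH_n(z_1)-(A_n+\Gamma_n)z_1^n\Big]\\&+\sum_{n=a}^{b-1}\Big[(A_n+\Gamma_n+D_n)K^n(z_1)\Big(F_{n-a+1}(z_1,z_2)\mathcal D(z_1)+Q_n(z_1)F_{b-a+1}(z_1,z_2)K^b(z_1)\Big)\\&\qquad-F_{b-a+1}(z_1,z_2)K^b(z_1)(A_n+\Gamma_n)z_1^n\Big].\end{aligned}$$ -/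

import Mathlib

open scoped ENNReal

namespace GeoQueue

/-- The parameters of the discrete-time queue `Geo^X / G_{n,k}^{(a,b)} / 1` with a first essential
service (FES), a second optional service (SOS) and queue-length-dependent vacations.
Durations are numbers of slots, hence `ℕ+`-valued; the law of a duration whose index is outside
the range used by the queue plays no role. -/
structure Model where
  /-- minimum size of a batch -/
  a : ℕ
  /-- maximum size of a batch -/
  b : ℕ
  one_le_a : 1 ≤ a
  a_le_b : a ≤ b
  /-- probability that a group of customers arrives in a slot -/
  lam : ℝ
  lam_pos : 0 < lam
  lam_le_one : lam ≤ 1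
  /-- probability that a customer opts for the SOS -/
  p : ℝ
  p_pos : 0 < p
  p_lt_one : p < 1
  /-- law of the size of an arriving group -/
  g : PMF ℕ
  g_zero : g 0 = 0
  /-- law of the FES time of a batch of size `r`, used for `a ≤ r ≤ b` -/
  S : ℕ → PMF ℕ+
  /-- law of the SOS time of a batch of size `y`, used for `1 ≤ y ≤ b` -/
  SO : ℕ → PMF ℕ+
  /-- law of the duration of a vacation of type `k`, used for `k ≤ a - 1` -/
  V : ℕ → PMF ℕ+
  /-- `true` for the multiple vacation policy, `false` for the single vacation policy -/
  multiple : Bool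

/-- State of the system: the number `n` of waiting customers, what the server does, and (unless
the server is dormant) the number `ℓ` of slots that remain before it has finished doing so. -/
inductive State where
  /-- the server is dormant -/
  | dormant (n : ℕ) : State
  /-- the server provides the FES to a batch of size `r` -/
  | fes (n r : ℕ) (ℓ : ℕ+) : State
  /-- the server provides the SOS to a batch of size `j` -/
  | sos (n j : ℕ) (ℓ : ℕ+) : State
  /-- the server is on a vacation of type `k` -/
  | vac (n k : ℕ) (ℓ : ℕ+) : State

/-- `x` customers join the queue. -/
def State.arrive : State → ℕ → State
  | .dormant n, x => .dormant (n + x)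
  | .fes n r ℓ, x => .fes (n + x) r ℓ
  | .sos n j ℓ, x => .sos (n + x) j ℓ
  | .vac n k ℓ, x => .vac (n + x) k ℓ

/-- A service or a vacation is in its last slot. -/
def State.IsCompleting : State → Prop
  | .dormant _ => False
  | .fes _ _ ℓ => ℓ = 1
  | .sos _ _ ℓ => ℓ = 1
  | .vac _ _ ℓ => ℓ = 1

/-- The set of the states in which a service or a vacation is in its last slot. -/
def completing : Set State := {s | s.IsCompleting}

namespace Model

noncomputable section

variable (M : Model)

/-- The policy indicator: `0` for single and `1` for multiple vacations. -/
def delta : ℝ := if M.multiple then 1 else 0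

/-- The binomial probability that `y` out of `r` customers opt for the SOS. -/
def chi (r y : ℕ) : ℝ := (r.choose y : ℝ) * M.p ^ y * (1 - M.p) ^ (r - y)

theorem chi_nonneg (r y : ℕ) : 0 ≤ M.chi r y := by
  have h1 := M.p_pos.le
  have h2 : 0 ≤ 1 - M.p := by linarith [M.p_lt_one]
  unfold chi
  positivity

theorem sum_chi (r : ℕ) : ∑ y : Fin (r + 1), ENNReal.ofReal (M.chi r y) = 1 := by
  rw [Fin.sum_univ_eq_sum_range (fun y => ENNReal.ofReal (M.chi r y)) (r + 1),
    ← ENNReal.ofReal_sum_of_nonneg (fun i _ => M.chi_nonneg r i), ENNReal.ofReal_eq_one]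
  have h := add_pow M.p (1 - M.p) r
  rw [add_sub_cancel, one_pow] at h
  rw [h]
  exact Finset.sum_congr rfl fun y _ => by unfold chi; ring

/-- The law of the number of those customers of a batch of size `r` that opt for the SOS. -/
def optLaw (r : ℕ) : PMF (Fin (r + 1)) :=
  PMF.ofFintype (fun y => ENNReal.ofReal (M.chi r y)) (M.sum_chi r)

/-- The probability that `x` customers arrive in a slot. -/
def arrivalProb (x : ℕ) : ℝ≥0∞ :=
  (if x = 0 then ENNReal.ofReal (1 - M.lam) else 0) + ENNReal.ofReal M.lam * M.g x

theorem tsum_arrivalProb : ∑' x, M.arrivalProb x = 1 := by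
  unfold arrivalProb
  rw [ENNReal.tsum_add, ENNReal.tsum_mul_left, M.g.tsum_coe, tsum_ite_eq, mul_one,
    ← ENNReal.ofReal_add (by linarith [M.lam_le_one]) M.lam_pos.le]
  simp

/-- The law of the number of customers that arrive in a slot. -/
def arrivalLaw : PMF ℕ :=
  ⟨M.arrivalProb, by rw [← M.tsum_arrivalProb]; exact ENNReal.summable.hasSum⟩

/-- The server takes the next batch from a queue of `n ≥ a` customers: all of them if `n ≤ b`,
and `b` of them otherwise. -/
def startFES (n : ℕ) : PMF State :=
  (M.S (min n M.b)).map (State.fes (n - min n M.b) (min n M.b))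

/-- With `n` customers in the queue, the server starts a vacation of type `n`. -/
def startVac (n : ℕ) : PMF State := (M.V n).map (State.vac n n)

/-- A batch of customers has left the system, with `n` customers in the queue. -/
def afterBatch (n : ℕ) : PMF State := if M.a ≤ n then M.startFES n else M.startVac n

/-- A vacation has ended with `n` customers in the queue. -/
def afterVac (n : ℕ) : PMF State :=
  if M.a ≤ n then M.startFES n
  else if M.multiple then M.startVac n else PMF.pure (.dormant n)

/-- The FES of a batch of size `r` has ended with `n` customers in the queue. -/
def afterFES (n r : ℕ) : PMF State :=
  (M.optLaw r).bind fun y =>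
    if (y : ℕ) = 0 then M.afterBatch n else (M.SO y).map (State.sos n y)

/-- What the server does at the end of a slot, after the arrivals of this slot. -/
def serve : State → PMF State
  | .dormant n => if M.a ≤ n then M.startFES n else PMF.pure (.dormant n)
  | .fes n r ℓ => if ℓ = 1 then M.afterFES n r else PMF.pure (.fes n r (ℓ - 1))
  | .sos n j ℓ => if ℓ = 1 then M.afterBatch n else PMF.pure (.sos n j (ℓ - 1))
  | .vac n k ℓ => if ℓ = 1 then M.afterVac n else PMF.pure (.vac n k (ℓ - 1))

/-- From the law of the state at time `t-` to the law of the state after the arrivals in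
`(t-, t)` and before the departures in `(t, t+)`. -/
def arrivals (μ : PMF State) : PMF State :=
  μ.bind fun s => M.arrivalLaw.map s.arrive

/-- From the law of the state at time `t-` to the law of the state at time `(t+1)-`: late
arrivals, delayed access. -/
def step (μ : PMF State) : PMF State := (M.arrivals μ).bind M.serve

/-- The law of the state at time `t-`, if the law of the state at time `0-` is `μ₀`. -/
def law (μ₀ : PMF State) (t : ℕ) : PMF State := M.step^[t] μ₀

/-- `π` is the limiting distribution of the state for some initial distribution. -/
def IsSteadyState (π : PMF State) : Prop :=
  ∃ μ₀ : PMF State, ∀ s, Filter.Tendsto (fun t => M.law μ₀ t s) Filter.atTop (nhds (π s))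

/-- If `π` is the law of the state at `t-`: the probability that a service or a vacation is
completed in `(t, t+)`. -/
def completionProb (π : PMF State) : ℝ≥0∞ := ∑' s, completing.indicator (M.arrivals π) s

/-- If `π` is the law of the state at `t-`: the conditional probability, given that a service or
a vacation is completed in `(t, t+)`, that the state just before this completion is `s`. -/
def completionLaw (π : PMF State) (s : State) : ℝ :=
  (completing.indicator (M.arrivals π) s / M.completionProb π).toReal

/-- `α⁺_{n,r}`: an FES of `r` customers has just been completed, `n` customers are in the queue. -/
def alpha (π : PMF State) (n r : ℕ) : ℝ := M.completionLaw π (.fes n r 1)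

/-- `β⁺_{n,j}`: an SOS of `j` customers has just been completed, `n` customers are in the queue. -/
def beta (π : PMF State) (n j : ℕ) : ℝ := M.completionLaw π (.sos n j 1)

/-- `γ⁺_n^{[k]}`: a vacation of type `k` has just been completed, `n` customers are in the queue. -/
def gamma (π : PMF State) (n k : ℕ) : ℝ := M.completionLaw π (.vac n k 1)

/-- The bivariate pgf `Π⁺(z₁, z₂) = ∑_{n ≥ 0} ∑_{a ≤ r ≤ b} α⁺_{n,r} z₁ⁿ z₂ʳ`. -/
def Pgf (π : PMF State) (z₁ z₂ : ℂ) : ℂ :=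
  ∑' n : ℕ, ∑ r ∈ Finset.Icc M.a M.b, (M.alpha π n r : ℂ) * z₁ ^ n * z₂ ^ r

/-- The bivariate pgf `Δ⁺(z₁, z₂) = ∑_{n ≥ 0} ∑_{1 ≤ y ≤ b} β⁺_{n,y} z₁ⁿ z₂ʸ`. -/
def Dgf (π : PMF State) (z₁ z₂ : ℂ) : ℂ :=
  ∑' n : ℕ, ∑ y ∈ Finset.Icc 1 M.b, (M.beta π n y : ℂ) * z₁ ^ n * z₂ ^ y

/-- The probability `g_i` that an arriving group has size `i`. -/
def gc (i : ℕ) : ℝ := (M.g i).toReal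

/-- The pgf of the size of an arriving group. -/
def G (z : ℂ) : ℂ := ∑' i : ℕ, (M.gc i : ℂ) * z ^ i

/-- The `z`-transform of the law of a duration. -/
def zTransform (D : PMF ℕ+) (z : ℂ) : ℂ := ∑' ℓ : ℕ+, ((D ℓ).toReal : ℂ) * z ^ (ℓ : ℕ)

/-- The pgf of the number of arrivals during a duration with law `D`. -/
def arrGF (D : PMF ℕ+) (z : ℂ) : ℂ := zTransform D ((1 - M.lam : ℝ) + (M.lam : ℂ) * M.G z)

/-- `K^r(z)`, for the FES time of `r` customers. -/
def K (r : ℕ) (z : ℂ) : ℂ := M.arrGF (M.S r) z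

/-- `T^y(z)`, for the SOS time of `y` customers. -/
def T (y : ℕ) (z : ℂ) : ℂ := M.arrGF (M.SO y) z

/-- `H_k(z)`, for a vacation of type `k`. -/
def H (k : ℕ) (z : ℂ) : ℂ := M.arrGF (M.V k) z

/-- `F_i(z₁, z₂)`, used for `1 ≤ i ≤ b - a + 1`. -/
def F (i : ℕ) (z₁ z₂ : ℂ) : ℂ :=
  ∑ y ∈ Finset.Icc 1 (M.a + i - 1), (M.chi (M.a + i - 1) y : ℂ) * z₂ ^ y * M.T y z₁

/-- `e_{n,i}`, used for `i ≤ n`: `e_{n,n} = 1` and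
`e_{n,i} = ∑_{j=i+1}^{n-1} e_{n,j} g_{j-i} + g_{n-i}` for `i < n`. -/
def e (n i : ℕ) : ℝ :=
  if n ≤ i then 1
  else ∑ j : Finset.Ioo i n, e n j * M.gc (j - i) + M.gc (n - i)
termination_by n - i
decreasing_by
  have := Finset.mem_Ioo.1 j.2
  omega

/-- `∑_{ℓ=a}^{b} α⁺_{n,ℓ} χ_{ℓ,0} + ∑_{j=1}^{b} β⁺_{n,j}`. -/
def A (π : PMF State) (n : ℕ) : ℝ :=
  ∑ l ∈ Finset.Icc M.a M.b, M.alpha π n l * M.chi l 0 + ∑ j ∈ Finset.Icc 1 M.b, M.beta π n j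

/-- `∑_{k=0}^{a-1} γ⁺_n^{[k]}`. -/
def Gam (π : PMF State) (n : ℕ) : ℝ := ∑ k ∈ Finset.range M.a, M.gamma π n k

/-- `∑_{i ≥ b+1-j} g_i zⁱ⁺ʲ`, used for `j ≤ a - 1`. -/
def gTail (j : ℕ) (z : ℂ) : ℂ :=
  ∑' i : ℕ, if M.b + 1 - j ≤ i then (M.gc i : ℂ) * z ^ (i + j) else 0

/-- The common denominator. -/
def den (z₁ : ℂ) : ℂ :=
  z₁ ^ M.b - (M.chi M.b 0 + M.F (M.b - M.a + 1) z₁ 1) * M.K M.b z₁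

/-- `(1-δ_p) ∑_{ℓ=0}^{a-1} ∑_{k=0}^{ℓ} γ⁺_ℓ^{[k]} ∑_{j=ℓ}^{a-1} e_{j,ℓ} g_{n-j}`, for `n ≥ a`. -/
def D (π : PMF State) (n : ℕ) : ℝ :=
  (1 - M.delta) * ∑ l ∈ Finset.range M.a, ∑ k ∈ Finset.range (l + 1),
    M.gamma π l k * ∑ j ∈ Finset.Ico l M.a, M.e j l * M.gc (n - j)

/-- The numerator of `Π⁺(z₁, z₂)`. -/
def numP (π : PMF State) (z₁ z₂ : ℂ) : ℂ :=
  ∑ n ∈ Finset.range M.a,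
    ((1 - M.delta : ℝ) * (∑ k ∈ Finset.range (n + 1), M.gamma π n k : ℝ) *
        ∑ j ∈ Finset.Ico n M.a, (M.e j n : ℂ) *
          (∑ i ∈ Finset.Icc M.a M.b, (M.gc (i - j) : ℂ) * M.K i z₁ * z₂ ^ i * z₁ ^ M.b
            + M.gTail j z₁ * M.K M.b z₁ * z₂ ^ M.b
            - ∑ i ∈ Finset.Ico M.a M.b, (M.gc (i - j) : ℂ) * M.K i z₁ * z₂ ^ i *
                (M.chi M.b 0 + M.F (M.b - M.a + 1) z₁ 1) * M.K M.b z₁)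
      + (M.A π n + M.delta * M.Gam π n : ℝ) * z₁ ^ n * M.H n z₁ * M.K M.b z₁ * z₂ ^ M.b
      - (M.A π n + M.Gam π n : ℝ) * z₁ ^ n * M.K M.b z₁ * z₂ ^ M.b)
  + ∑ n ∈ Finset.Ico M.a M.b,
    ((M.A π n + M.Gam π n : ℝ) * z₂ ^ n * M.K n z₁ * M.den z₁
      + M.K M.b z₁ * z₂ ^ M.b *
        (M.K n z₁ * (M.A π n + M.Gam π n + M.D π n : ℝ) *
            (M.chi n 0 + M.F (n - M.a + 1) z₁ 1)
          - (M.A π n + M.Gam π n : ℝ) * z₁ ^ n))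

/-- The numerator of `Δ⁺(z₁, z₂)`. -/
def numD (π : PMF State) (z₁ z₂ : ℂ) : ℂ :=
  ∑ n ∈ Finset.range M.a, M.F (M.b - M.a + 1) z₁ z₂ * M.K M.b z₁ *
    ((1 - M.delta : ℝ) * (∑ k ∈ Finset.range (n + 1), M.gamma π n k : ℝ) *
        ∑ j ∈ Finset.Ico n M.a, (M.e j n : ℂ) *
          ((M.gc (M.b - j) : ℂ) * z₁ ^ M.b + M.gTail j z₁)
      + (M.A π n + M.delta * M.Gam π n : ℝ) * z₁ ^ n * M.H n z₁
      - (M.A π n + M.Gam π n : ℝ) * z₁ ^ n)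
  + ∑ n ∈ Finset.Ico M.a M.b,
    ((M.A π n + M.Gam π n + M.D π n : ℝ) * M.K n z₁ *
        (M.F (n - M.a + 1) z₁ z₂ * M.den z₁
          + (M.chi n 0 + M.F (n - M.a + 1) z₁ 1) * M.F (M.b - M.a + 1) z₁ z₂ * M.K M.b z₁)
      - M.F (M.b - M.a + 1) z₁ z₂ * M.K M.b z₁ * (M.A π n + M.Gam π n : ℝ) * z₁ ^ n)

end

end Model

end GeoQueue

/-! A pointwise limit of the laws of a Markov chain that still has mass one is invariant
(`bind_eq_of_tendsto`). The balance equations therefore hold, with `P` the law at t- and `Q` its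
image after the arrivals of a slot.

All activities (FES of a given size, SOS of a given size, vacation of a given type) obey one
recursion. Let φ_l(z) be the generating function, in the queue length, of the mass with l slots
left, σ(z) that of the starts, d the law of the duration and x = λ̄ + λG(z). Then φ_l = xφ_{l+1} +
d_l σ. Multiplying by x^l and summing over l telescopes to xφ_1 = d*(x)σ: completions are starts
times K, T or H (`gf_completionRate`).

It remains to know the starts. An FES of size r < b starts only from a queue of exactly r and leaves
it empty, so its σ is a constant. An FES of size b leaves n out of n + b customers; if Y is its σ,
then z^b Y collects the terms of degree at least b among batch departures, ends of vacations and
dormant queues after arrivals. The batch departures contain Q_b K^b Y, and moving this term to the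
left produces 𝒟Y (`gf_fesRate_mul_den`). The dormant masses below a are explicit in the e_{n,l}, and
their jumps to a or above give D_n (`dormant_eq`, `dormant_arr_eq`). Both stated numerators are
rearrangements of expressions in this one bracket 𝒟Y (`numP_eq`, `numD_eq`).

The equations are homogeneous in (P, Q), so dividing by the completion probability makes `Q` the
conditional law on completing states. That probability is positive because a stationary measure
without completions vanishes (`eq_zero_of_completing`). -/

namespace GeoQueue

/-! ### Sums over states, and invariance of limit laws. -/

/-- The states, listed by kind. -/
def State.equivSum :
    State ≃ ℕ ⊕ (ℕ × ℕ × ℕ+) ⊕ (ℕ × ℕ × ℕ+) ⊕ (ℕ × ℕ × ℕ+) where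
  toFun
    | .dormant n => .inl n
    | .fes n r l => .inr (.inl (n, r, l))
    | .sos n j l => .inr (.inr (.inl (n, j, l)))
    | .vac n k l => .inr (.inr (.inr (n, k, l)))
  invFun
    | .inl n => .dormant n
    | .inr (.inl (n, r, l)) => .fes n r l
    | .inr (.inr (.inl (n, j, l))) => .sos n j l
    | .inr (.inr (.inr (n, k, l))) => .vac n k l
  left_inv s := by cases s <;> rfl
  right_inv s := by rcases s with _ | _ | _ | _ <;> rfl

theorem State.tsum_eq (f : State → ℝ≥0∞) :
    ∑' s, f s = ∑' n, f (.dormant n) + ((∑' n, ∑' r, ∑' l, f (.fes n r l)) +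
      ((∑' n, ∑' j, ∑' l, f (.sos n j l)) + ∑' n, ∑' k, ∑' l, f (.vac n k l))) := by
  rw [← State.equivSum.symm.tsum_eq, Summable.tsum_sum ENNReal.summable ENNReal.summable,
    Summable.tsum_sum ENNReal.summable ENNReal.summable,
    Summable.tsum_sum ENNReal.summable ENNReal.summable]
  simp only [ENNReal.tsum_prod']
  rfl

theorem tsum_pnat_eq_add (f : ℕ+ → ℝ≥0∞) : ∑' l, f l = f 1 + ∑' l, f (l + 1) := by
  rw [← Equiv.pnatEquivNat.symm.tsum_eq f, tsum_eq_zero_add' ENNReal.summable,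
    ← Equiv.pnatEquivNat.symm.tsum_eq fun l => f (l + 1)]
  rfl

theorem tsum_tsum_tsum_ite (f : ℕ → ℕ → ℕ+ → ℝ≥0∞) (n r : ℕ) (l : ℕ+) :
    (∑' n', ∑' r', ∑' l', f n' r' l' * if n = n' ∧ r = r' ∧ l = l' then 1 else 0) = f n r l := by
  rw [tsum_eq_single n, tsum_eq_single r, tsum_eq_single l]
  · simp
  · intro l' h; simp [h.symm]
  · intro r' h; simp [h.symm]
  · intro n' h; simp [h.symm]

/-- Both total masses are one, so a strict inequality at one point would make them differ. -/
theorem eq_of_forall_le {α : Type*} {μ ν : PMF α} (h : ∀ x, μ x ≤ ν x) : μ = ν := by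
  ext x
  by_contra hx
  have := ENNReal.tsum_lt_tsum (i := x) μ.tsum_coe_ne_top h (lt_of_le_of_ne (h x) hx)
  rw [μ.tsum_coe, ν.tsum_coe] at this
  exact lt_irrefl _ this

/-- A pointwise limit of the iterates of a Markov kernel is invariant, if it is a probability
distribution. -/
theorem bind_eq_of_tendsto {α : Type*} {k : α → PMF α} {μ : ℕ → PMF α} {ν : PMF α}
    (hμ : ∀ t, μ (t + 1) = (μ t).bind k)
    (h : ∀ x, Filter.Tendsto (fun t => μ t x) Filter.atTop (nhds (ν x))) : ν.bind k = ν := by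
  -- Fatou: finite partial sums pass to the limit and give only an inequality; equality of the
  -- masses supplies the rest.
  refine eq_of_forall_le fun x => ?_
  rw [PMF.bind_apply, ENNReal.tsum_eq_iSup_sum]
  refine iSup_le fun F => ?_
  refine le_of_tendsto_of_tendsto (tendsto_finsetSum F fun y _ =>
    ENNReal.Tendsto.mul_const (h y) (Or.inr (PMF.apply_ne_top _ _)))
    ((Filter.tendsto_add_atTop_iff_nat 1).2 (h x)) (Filter.Eventually.of_forall fun t => ?_)
  simp only [hμ, PMF.bind_apply]
  exact ENNReal.sum_le_tsum F

namespace Model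

variable (M : Model)

theorem step_eq_of_isSteadyState {π : PMF State} (hπ : M.IsSteadyState π) : M.step π = π := by
  obtain ⟨μ₀, h⟩ := hπ
  -- Arrivals and service are merged into a single Markov kernel.
  have hs : ∀ μ, M.step μ = μ.bind fun s => (M.arrivalLaw.map s.arrive).bind M.serve := fun μ =>
    PMF.bind_bind _ _ _
  rw [hs]
  refine bind_eq_of_tendsto (μ := fun t => M.law μ₀ t) (fun t => ?_) h
  rw [← hs, law, Function.iterate_succ_apply']
  rfl

/-- With the activity and its remaining time fixed, the states form a copy of ℕ on which arrivals
act by translation and which they neither enter nor leave; hence a Cauchy product. The map `c` lets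
one proof serve all four kinds of states. -/
theorem arrivals_apply (π : PMF State) (c : ℕ → State) (hc : Function.Injective c)
    (h : ∀ m x, (c m).arrive x = c (m + x))
    (h' : ∀ s x n, s.arrive x = c n → s ∈ Set.range c) (n : ℕ) :
    M.arrivals π (c n) =
      ∑ x ∈ Finset.HasAntidiagonal.antidiagonal n, π (c x.1) * M.arrivalProb x.2 := by
  classical
  rw [arrivals, PMF.bind_apply, ← hc.tsum_eq]
  · simp only [PMF.map_apply, h, hc.eq_iff, ← ENNReal.tsum_mul_left]
    rw [← ENNReal.tsum_prod (f := fun m x => π (c m) * if n = m + x then M.arrivalLaw x else 0),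
      tsum_eq_sum (s := Finset.HasAntidiagonal.antidiagonal n)]
    · refine Finset.sum_congr rfl fun x hx => ?_
      rw [if_pos (Finset.HasAntidiagonal.mem_antidiagonal.1 hx).symm]
      rfl
    · intro x hx
      rw [if_neg fun e => hx (Finset.HasAntidiagonal.mem_antidiagonal.2 e.symm), mul_zero]
  · intro s hs
    by_contra hr
    refine hs ?_
    change π s * (PMF.map s.arrive M.arrivalLaw) (c n) = 0
    rw [PMF.map_apply]
    simp only [mul_eq_zero, ENNReal.tsum_eq_zero, ite_eq_right_iff]
    exact Or.inr fun x e => (hr (h' s x n e.symm)).elim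

/-! ### Balance equations. -/

/-- The rate at which batches leave the system with `n` customers in the queue. -/
noncomputable def batchRate (Q : State → ℝ≥0∞) (n : ℕ) : ℝ≥0∞ :=
  ∑' r, Q (.fes n r 1) * ENNReal.ofReal (M.chi r 0) + ∑' j, Q (.sos n j 1)

/-- The rate at which vacations end with `n` customers in the queue. -/
noncomputable def vacRate (Q : State → ℝ≥0∞) (n : ℕ) : ℝ≥0∞ := ∑' k, Q (.vac n k 1)

/-- The rate at which the FES of a batch of `r` customers starts and leaves `n` customers in the
queue. -/
noncomputable def fesRate (Q : State → ℝ≥0∞) (n r : ℕ) : ℝ≥0∞ :=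
  ∑' m, (Q (.dormant m) + M.batchRate Q m + vacRate Q m) *
    if M.a ≤ m ∧ n = m - min m M.b ∧ r = min m M.b then 1 else 0

/-- `P` is a finite stationary measure of the queue at `t-`, and `Q` is its image after the
arrivals of a slot. -/
structure IsStationary (P Q : State → ℝ≥0∞) : Prop where
  tsum_ne_top : ∑' s, P s ≠ ∞
  tsum_ne_top' : ∑' s, Q s ≠ ∞
  dormant_arr n : Q (.dormant n) =
    ∑ x ∈ Finset.HasAntidiagonal.antidiagonal n, P (.dormant x.1) * M.arrivalProb x.2
  fes_arr n r l : Q (.fes n r l) =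
    ∑ x ∈ Finset.HasAntidiagonal.antidiagonal n, P (.fes x.1 r l) * M.arrivalProb x.2
  sos_arr n j l : Q (.sos n j l) =
    ∑ x ∈ Finset.HasAntidiagonal.antidiagonal n, P (.sos x.1 j l) * M.arrivalProb x.2
  vac_arr n k l : Q (.vac n k l) =
    ∑ x ∈ Finset.HasAntidiagonal.antidiagonal n, P (.vac x.1 k l) * M.arrivalProb x.2
  dormant_bal n : P (.dormant n) =
    if n < M.a then Q (.dormant n) + (if M.multiple then 0 else vacRate Q n) else 0
  fes_bal n r l : P (.fes n r l) = Q (.fes n r (l + 1)) + M.fesRate Q n r * M.S r l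
  sos_bal n j l : P (.sos n j l) = Q (.sos n j (l + 1)) +
    (if j = 0 then 0 else ∑' r, Q (.fes n r 1) * ENNReal.ofReal (M.chi r j)) * M.SO j l
  vac_bal n k l : P (.vac n k l) = Q (.vac n k (l + 1)) +
    (if n = k ∧ k < M.a then M.batchRate Q n + (if M.multiple then vacRate Q n else 0) else 0) *
      M.V k l

theorem startFES_fes (m n r : ℕ) (l : ℕ+) : M.startFES m (.fes n r l) =
    if n = m - min m M.b ∧ r = min m M.b then M.S r l else 0 := by
  rw [startFES, PMF.map_apply]
  simp only [State.fes.injEq]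
  split_ifs with h
  · simp [h.1, ← h.2]
  · simp only [← and_assoc, h, false_and, if_false, tsum_zero]

theorem startFES_of_ne (m : ℕ) (s : State) (h : ∀ n r l, s ≠ .fes n r l) :
    M.startFES m s = 0 := by
  rw [startFES, PMF.map_apply]
  simp [h]

theorem startVac_vac (m n k : ℕ) (l : ℕ+) : M.startVac m (.vac n k l) =
    if n = m ∧ k = m then M.V k l else 0 := by
  rw [startVac, PMF.map_apply]
  simp only [State.vac.injEq]
  split_ifs with h
  · simp [h.1, h.2]
  · simp only [← and_assoc, h, false_and, if_false, tsum_zero]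

theorem startVac_of_ne (m : ℕ) (s : State) (h : ∀ n k l, s ≠ .vac n k l) :
    M.startVac m s = 0 := by
  rw [startVac, PMF.map_apply]
  simp [h]

theorem afterFES_of_ne (m r : ℕ) (s : State) (h : ∀ n j l, s ≠ .sos n j l) :
    M.afterFES m r s = ENNReal.ofReal (M.chi r 0) * M.afterBatch m s := by
  rw [afterFES, PMF.bind_apply, tsum_eq_single 0]
  · simp [optLaw]
  · intro y hy
    have : (y : ℕ) ≠ 0 := fun e => hy (Fin.ext e)
    rw [if_neg this, PMF.map_apply]
    simp [h]

theorem afterBatch_sos (m n j : ℕ) (l : ℕ+) : M.afterBatch m (.sos n j l) = 0 := by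
  rw [afterBatch]
  split_ifs
  · exact M.startFES_of_ne _ _ (by simp)
  · exact M.startVac_of_ne _ _ (by simp)

theorem afterVac_sos (m n j : ℕ) (l : ℕ+) : M.afterVac m (.sos n j l) = 0 := by
  rw [afterVac]
  split_ifs
  · exact M.startFES_of_ne _ _ (by simp)
  · exact M.startVac_of_ne _ _ (by simp)
  · simp

theorem chi_of_lt {r y : ℕ} (h : r < y) : M.chi r y = 0 := by
  simp [chi, Nat.choose_eq_zero_of_lt h]

theorem afterFES_sos (m r n j : ℕ) (l : ℕ+) : M.afterFES m r (.sos n j l) =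
    if n = m ∧ j ≠ 0 then ENNReal.ofReal (M.chi r j) * M.SO j l else 0 := by
  have key (y : Fin (r + 1)) :
      (if (y : ℕ) = 0 then M.afterBatch m else (M.SO y).map (State.sos m y)) (.sos n j l) =
        if n = m ∧ j ≠ 0 ∧ j = y then M.SO j l else 0 := by
    split_ifs with h h1 h1
    · omega
    · exact M.afterBatch_sos _ _ _ _
    · rw [PMF.map_apply]
      simp [h1.1, ← h1.2.2]
    · rw [PMF.map_apply]
      simp only [State.sos.injEq]
      have : ¬ (n = m ∧ j = y) := fun e => h1 ⟨e.1, by omega, e.2⟩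
      simp only [← and_assoc, this, false_and, if_false, tsum_zero]
  rw [afterFES, PMF.bind_apply]
  simp only [key]
  split_ifs with h
  · by_cases hj : j ≤ r
    · rw [tsum_eq_single ⟨j, by omega⟩]
      · rw [if_pos ⟨h.1, h.2, rfl⟩]
        rfl
      · intro y hy
        rw [if_neg fun e => hy (Fin.ext e.2.2.symm), mul_zero]
    -- For j > r no value of the binomial variable equals j, and the right-hand side vanishes
    -- because the binomial coefficient does.
    · rw [M.chi_of_lt (by omega)]
      simp only [ENNReal.ofReal_zero, zero_mul, ENNReal.tsum_eq_zero]
      intro y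
      rw [if_neg (by omega), mul_zero]
  · simp only [ENNReal.tsum_eq_zero]
    intro y
    rw [if_neg fun e => h ⟨e.1, e.2.1⟩, mul_zero]

/-- The last slot, where the server makes a decision, is split from remaining times `l + 1`, where
only the counter drops. Against a fixed target, the counter sums reduce to at most one term. -/
theorem bind_serve_apply (q : PMF State) (s : State) : q.bind M.serve s =
    ∑' n, q (.dormant n) * M.serve (.dormant n) s +
    ((∑' n, ∑' r, (q (.fes n r 1) * M.afterFES n r s +
        ∑' l, q (.fes n r (l + 1)) * PMF.pure (State.fes n r l) s)) +
    ((∑' n, ∑' j, (q (.sos n j 1) * M.afterBatch n s +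
        ∑' l, q (.sos n j (l + 1)) * PMF.pure (State.sos n j l) s)) +
    ∑' n, ∑' k, (q (.vac n k 1) * M.afterVac n s +
        ∑' l, q (.vac n k (l + 1)) * PMF.pure (State.vac n k l) s))) := by
  have h : ∀ l : ℕ+, l + 1 ≠ 1 := fun l h => by
    have h2 := l.pos
    have := congrArg PNat.val h
    change (l : ℕ) + 1 = 1 at this
    omega
  have h' : ∀ l : ℕ+, l + 1 - 1 = l := fun l => PNat.add_sub
  rw [PMF.bind_apply, State.tsum_eq]
  simp only [tsum_pnat_eq_add (fun l => q (.fes _ _ l) * _),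
    tsum_pnat_eq_add (fun l => q (.sos _ _ l) * _),
    tsum_pnat_eq_add (fun l => q (.vac _ _ l) * _)]
  simp only [serve, if_true, h, if_false, h']

theorem afterBatch_fes (m n r : ℕ) (l : ℕ+) : M.afterBatch m (.fes n r l) =
    (if M.a ≤ m ∧ n = m - min m M.b ∧ r = min m M.b then 1 else 0) * M.S r l := by
  rw [afterBatch, ite_mul, one_mul, zero_mul]
  by_cases h : M.a ≤ m
  · simp only [h, if_true, true_and, startFES_fes]
  · simp only [h, if_false, false_and]
    exact M.startVac_of_ne _ _ (by simp)

theorem afterVac_fes (m n r : ℕ) (l : ℕ+) : M.afterVac m (.fes n r l) =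
    (if M.a ≤ m ∧ n = m - min m M.b ∧ r = min m M.b then 1 else 0) * M.S r l := by
  rw [afterVac, ite_mul, one_mul, zero_mul]
  by_cases h : M.a ≤ m
  · simp only [h, if_true, true_and, startFES_fes]
  · simp only [h, if_false, false_and]
    split_ifs
    · exact M.startVac_of_ne _ _ (by simp)
    · simp

/-- The test `m = n` is kept outermost so that the sum over `m` in the balance equation collapses.
-/
theorem afterBatch_vac (m n k : ℕ) (l : ℕ+) : M.afterBatch m (.vac n k l) =
    if m = n then if n = k ∧ k < M.a then M.V k l else 0 else 0 := by
  rw [afterBatch]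
  split_ifs with h h1 h2 h2 h3
  · omega
  · exact M.startFES_of_ne _ _ (by simp)
  · exact M.startFES_of_ne _ _ (by simp)
  · rw [startVac_vac, if_pos (by omega)]
  · rw [startVac_vac, if_neg (by omega)]
  · rw [startVac_vac, if_neg (by omega)]

theorem afterVac_vac (m n k : ℕ) (l : ℕ+) : M.afterVac m (.vac n k l) =
    if m = n then if n = k ∧ k < M.a then (if M.multiple then M.V k l else 0) else 0 else 0 := by
  by_cases hm : M.multiple
  · simpa only [afterVac, afterBatch, hm, if_true] using M.afterBatch_vac m n k l
  · simp only [afterVac, hm, Bool.false_eq_true, if_false, ite_self]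
    split_ifs
    · exact M.startFES_of_ne _ _ (by simp)
    · simp

theorem afterBatch_dormant (m n : ℕ) : M.afterBatch m (.dormant n) = 0 := by
  rw [afterBatch]
  split_ifs
  · exact M.startFES_of_ne _ _ (by simp)
  · exact M.startVac_of_ne _ _ (by simp)

theorem afterVac_dormant (m n : ℕ) : M.afterVac m (.dormant n) =
    if m = n then if n < M.a then (if M.multiple then 0 else 1) else 0 else 0 := by
  rw [afterVac]
  split_ifs with h h1 h2 h3 h1 h2 h3 h3 h3
  all_goals first
    | omega
    | exact M.startFES_of_ne _ _ (by simp)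
    | exact M.startVac_of_ne _ _ (by simp)
    | (rw [PMF.pure_apply, State.dormant.injEq]; exact if_pos (by omega))
    | (rw [PMF.pure_apply, State.dormant.injEq]; exact if_neg (by omega))

theorem serve_dormant_fes (m n r : ℕ) (l : ℕ+) : M.serve (.dormant m) (.fes n r l) =
    (if M.a ≤ m ∧ n = m - min m M.b ∧ r = min m M.b then 1 else 0) * M.S r l := by
  rw [serve, ite_mul, one_mul, zero_mul]
  by_cases h : M.a ≤ m
  · simp only [h, if_true, true_and, startFES_fes]
  · simp [h]

theorem serve_dormant_dormant (m n : ℕ) : M.serve (.dormant m) (.dormant n) =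
    if m = n then if n < M.a then 1 else 0 else 0 := by
  rw [serve]
  split_ifs with h h1 h2 h3 h3
  · omega
  · exact M.startFES_of_ne _ _ (by simp)
  · exact M.startFES_of_ne _ _ (by simp)
  · rw [PMF.pure_apply, State.dormant.injEq, if_pos (by omega)]
  · omega
  · rw [PMF.pure_apply, State.dormant.injEq, if_neg (by omega)]

theorem serve_dormant_of_ne (m : ℕ) (s : State) (h : ∀ n r l, s ≠ .fes n r l)
    (h' : ∀ n, s ≠ .dormant n) : M.serve (.dormant m) s = 0 := by
  rw [serve]
  split_ifs
  · exact M.startFES_of_ne _ _ h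
  · simp [h' m]

theorem bind_serve_dormant (q : PMF State) (n : ℕ) : q.bind M.serve (.dormant n) =
    if n < M.a then q (.dormant n) + (if M.multiple then 0 else vacRate q n) else 0 := by
  rw [bind_serve_apply]
  simp only [M.afterFES_of_ne _ _ (.dormant n) (by simp), afterBatch_dormant, PMF.pure_apply,
    reduceCtorEq, if_false, mul_zero, tsum_zero, add_zero, afterVac_dormant,
    serve_dormant_dormant, zero_add, mul_ite]
  have h1 (f : ℕ → ℝ≥0∞) : ∑' m, (if m = n then f m else 0) = f n := tsum_ite_eq n f
  have h2 (f : ℕ → ℕ → ℝ≥0∞) : ∑' m, ∑' k, (if m = n then f m k else 0) = ∑' k, f n k := by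
    rw [tsum_eq_single n]
    · simp
    · intro m hm
      simp [hm]
  rw [h1, h2]
  split_ifs <;> simp [vacRate]

theorem bind_serve_fes (q : PMF State) (n r : ℕ) (l : ℕ+) : q.bind M.serve (.fes n r l) =
    q (.fes n r (l + 1)) + M.fesRate q n r * M.S r l := by
  rw [bind_serve_apply]
  simp only [M.afterFES_of_ne _ _ (.fes n r l) (by simp), afterBatch_fes, afterVac_fes,
    serve_dormant_fes, PMF.pure_apply, reduceCtorEq, if_false, mul_zero, tsum_zero, add_zero,
    State.fes.injEq, ENNReal.tsum_add, tsum_tsum_tsum_ite]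
  simp only [fesRate, batchRate, vacRate, ← ENNReal.tsum_mul_right, add_mul, ENNReal.tsum_add]
  simp only [← mul_assoc]
  ring

theorem bind_serve_sos (q : PMF State) (n j : ℕ) (l : ℕ+) : q.bind M.serve (.sos n j l) =
    q (.sos n j (l + 1)) +
    (if j = 0 then 0 else ∑' r, q (.fes n r 1) * ENNReal.ofReal (M.chi r j)) * M.SO j l := by
  rw [bind_serve_apply]
  simp only [afterFES_sos, afterBatch_sos, afterVac_sos, M.serve_dormant_of_ne _ (.sos n j l)
    (by simp) (by simp), PMF.pure_apply, reduceCtorEq, if_false, mul_zero, tsum_zero, add_zero,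
    zero_add, State.sos.injEq, tsum_tsum_tsum_ite]
  rw [add_comm, tsum_eq_single n]
  · by_cases h : j = 0
    · simp [h]
    · simp [h, ← ENNReal.tsum_mul_right, mul_assoc]
  · intro m hm
    simp [hm.symm]

theorem bind_serve_vac (q : PMF State) (n k : ℕ) (l : ℕ+) : q.bind M.serve (.vac n k l) =
    q (.vac n k (l + 1)) +
    (if n = k ∧ k < M.a then M.batchRate q n + (if M.multiple then vacRate q n else 0) else 0) *
      M.V k l := by
  rw [bind_serve_apply]
  simp only [M.afterFES_of_ne _ _ (.vac n k l) (by simp), afterBatch_vac, afterVac_vac,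
    M.serve_dormant_of_ne _ (.vac n k l)
    (by simp) (by simp), PMF.pure_apply, reduceCtorEq, if_false, mul_zero, tsum_zero, add_zero,
    zero_add, State.vac.injEq, ENNReal.tsum_add, tsum_tsum_tsum_ite]
  simp only [mul_ite, mul_zero]
  have h2 (f : ℕ → ℕ → ℝ≥0∞) : ∑' m, ∑' k, (if m = n then f m k else 0) = ∑' k, f n k := by
    rw [tsum_eq_single n]
    · simp
    · intro m hm
      simp [hm]
  rw [h2, h2, h2]
  split_ifs
  · simp only [batchRate, vacRate, add_mul, ← ENNReal.tsum_mul_right, mul_assoc]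
    ring
  · simp only [batchRate, add_mul, ← ENNReal.tsum_mul_right, mul_assoc]
    simp only [tsum_zero, zero_add]
    ring
  · simp

theorem isStationary_of_isSteadyState {π : PMF State} (hπ : M.IsSteadyState π) :
    M.IsStationary π (M.arrivals π) := by
  have h : ∀ s, π s = (M.arrivals π).bind M.serve s := fun s =>
    congrArg (fun μ : PMF State => μ s) (M.step_eq_of_isSteadyState hπ).symm
  exact
  { tsum_ne_top := π.tsum_coe_ne_top
    tsum_ne_top' := (M.arrivals π).tsum_coe_ne_top
    dormant_arr := M.arrivals_apply π State.dormant
      (fun _ _ h => by simpa using h) (fun _ _ => rfl)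
      (fun s x n h => by cases s <;> simp_all [State.arrive])
    fes_arr n r l := M.arrivals_apply π (fun n => .fes n r l)
      (fun _ _ h => by simpa using h) (fun _ _ => rfl)
      (fun s x n h => by cases s <;> simp_all [State.arrive]) n
    sos_arr n j l := M.arrivals_apply π (fun n => .sos n j l)
      (fun _ _ h => by simpa using h) (fun _ _ => rfl)
      (fun s x n h => by cases s <;> simp_all [State.arrive]) n
    vac_arr n k l := M.arrivals_apply π (fun n => .vac n k l)
      (fun _ _ h => by simpa using h) (fun _ _ => rfl)
      (fun s x n h => by cases s <;> simp_all [State.arrive]) n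
    dormant_bal n := (h _).trans (M.bind_serve_dormant _ n)
    fes_bal n r l := (h _).trans (M.bind_serve_fes _ n r l)
    sos_bal n j l := (h _).trans (M.bind_serve_sos _ n j l)
    vac_bal n k l := (h _).trans (M.bind_serve_vac _ n k l) }

theorem batchRate_const_mul (c : ℝ≥0∞) (Q : State → ℝ≥0∞) (n : ℕ) :
    M.batchRate (fun s => c * Q s) n = c * M.batchRate Q n := by
  simp only [batchRate, mul_assoc, ENNReal.tsum_mul_left, mul_add]

theorem vacRate_const_mul (c : ℝ≥0∞) (Q : State → ℝ≥0∞) (n : ℕ) :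
    vacRate (fun s => c * Q s) n = c * vacRate Q n := by
  simp only [vacRate, ENNReal.tsum_mul_left]

theorem fesRate_const_mul (c : ℝ≥0∞) (Q : State → ℝ≥0∞) (n r : ℕ) :
    M.fesRate (fun s => c * Q s) n r = c * M.fesRate Q n r := by
  simp only [fesRate, batchRate_const_mul, vacRate_const_mul, ← mul_add, mul_assoc,
    ENNReal.tsum_mul_left]

-- The balance equations are linear and homogeneous. This is why they are stated for measures with
-- values in `ℝ≥0∞` and not for probability laws.
variable {M} in
theorem IsStationary.const_mul {P Q : State → ℝ≥0∞} (h : M.IsStationary P Q) {c : ℝ≥0∞}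
    (hc : c ≠ ∞) : M.IsStationary (fun s => c * P s) (fun s => c * Q s) where
  tsum_ne_top := by
    rw [ENNReal.tsum_mul_left]
    exact ENNReal.mul_ne_top hc h.tsum_ne_top
  tsum_ne_top' := by
    rw [ENNReal.tsum_mul_left]
    exact ENNReal.mul_ne_top hc h.tsum_ne_top'
  dormant_arr n := by simp only [h.dormant_arr, mul_assoc, Finset.mul_sum]
  fes_arr n r l := by simp only [h.fes_arr, mul_assoc, Finset.mul_sum]
  sos_arr n j l := by simp only [h.sos_arr, mul_assoc, Finset.mul_sum]
  vac_arr n k l := by simp only [h.vac_arr, mul_assoc, Finset.mul_sum]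
  dormant_bal n := by
    rw [h.dormant_bal, vacRate_const_mul]
    split_ifs <;> ring
  fes_bal n r l := by
    rw [h.fes_bal, fesRate_const_mul]
    ring
  sos_bal n j l := by
    simp only [h.sos_bal n j l, mul_assoc, ENNReal.tsum_mul_left]
    split_ifs <;> ring
  vac_bal n k l := by
    rw [h.vac_bal, vacRate_const_mul, batchRate_const_mul]
    split_ifs <;> ring

end Model

/-! ### Generating functions on the closed unit disc. -/

/-- The generating function of a sequence of extended nonnegative reals. -/
noncomputable def gf (f : ℕ → ℝ≥0∞) (z : ℂ) : ℂ := ∑' n, ((f n).toReal : ℂ) * z ^ n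

theorem norm_gf_term_le (f : ℕ → ℝ≥0∞) {z : ℂ} (hz : ‖z‖ ≤ 1) (n : ℕ) :
    ‖((f n).toReal : ℂ) * z ^ n‖ ≤ (f n).toReal := by
  rw [norm_mul, norm_pow, Complex.norm_real, Real.norm_of_nonneg ENNReal.toReal_nonneg]
  exact mul_le_of_le_one_right ENNReal.toReal_nonneg (pow_le_one₀ (norm_nonneg _) hz)

theorem summable_norm_gf {f : ℕ → ℝ≥0∞} (hf : ∑' n, f n ≠ ∞) {z : ℂ} (hz : ‖z‖ ≤ 1) :
    Summable fun n => ‖((f n).toReal : ℂ) * z ^ n‖ :=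
  (ENNReal.summable_toReal hf).of_nonneg_of_le (fun _ => norm_nonneg _) (norm_gf_term_le f hz)

theorem summable_gf {f : ℕ → ℝ≥0∞} (hf : ∑' n, f n ≠ ∞) {z : ℂ} (hz : ‖z‖ ≤ 1) :
    Summable fun n => ((f n).toReal : ℂ) * z ^ n := (summable_norm_gf hf hz).of_norm

theorem norm_gf_le {f : ℕ → ℝ≥0∞} (hf : ∑' n, f n ≠ ∞) {z : ℂ} (hz : ‖z‖ ≤ 1) :
    ‖gf f z‖ ≤ (∑' n, f n).toReal := by
  rw [ENNReal.tsum_toReal_eq (ENNReal.ne_top_of_tsum_ne_top hf)]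
  exact tsum_of_norm_bounded (ENNReal.summable_toReal hf).hasSum (norm_gf_term_le f hz)

theorem gf_add {f h : ℕ → ℝ≥0∞} (hf : ∑' n, f n ≠ ∞) (hh : ∑' n, h n ≠ ∞) {z : ℂ}
    (hz : ‖z‖ ≤ 1) : gf (fun n => f n + h n) z = gf f z + gf h z := by
  rw [gf, gf, gf, ← (summable_gf hf hz).tsum_add (summable_gf hh hz)]
  refine tsum_congr fun n => ?_
  rw [ENNReal.toReal_add (ENNReal.ne_top_of_tsum_ne_top hf n)
    (ENNReal.ne_top_of_tsum_ne_top hh n)]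
  push_cast
  ring

theorem gf_mul_const (f : ℕ → ℝ≥0∞) (c : ℝ≥0∞) (z : ℂ) :
    gf (fun n => f n * c) z = gf f z * c.toReal := by
  rw [gf, gf, ← tsum_mul_right]
  refine tsum_congr fun n => ?_
  rw [ENNReal.toReal_mul]
  push_cast
  ring

theorem gf_sum {ι : Type*} (s : Finset ι) {f : ι → ℕ → ℝ≥0∞}
    (hf : ∀ i ∈ s, ∑' n, f i n ≠ ∞) {z : ℂ} (hz : ‖z‖ ≤ 1) :
    gf (fun n => ∑ i ∈ s, f i n) z = ∑ i ∈ s, gf (f i) z := by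
  simp only [gf]
  rw [← Summable.tsum_finsetSum fun i hi => summable_gf (hf i hi) hz]
  refine tsum_congr fun n => ?_
  rw [ENNReal.toReal_sum fun i hi => ENNReal.ne_top_of_tsum_ne_top (hf i hi) n]
  push_cast
  rw [Finset.sum_mul]

/-- The Cauchy product of two sequences. -/
noncomputable def conv (f h : ℕ → ℝ≥0∞) (n : ℕ) : ℝ≥0∞ :=
  ∑ x ∈ Finset.HasAntidiagonal.antidiagonal n, f x.1 * h x.2

theorem gf_conv {f h : ℕ → ℝ≥0∞} (hf : ∑' n, f n ≠ ∞) (hh : ∑' n, h n ≠ ∞) {z : ℂ}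
    (hz : ‖z‖ ≤ 1) : gf (conv f h) z = gf f z * gf h z := by
  rw [gf, gf, gf, tsum_mul_tsum_eq_tsum_sum_antidiagonal_of_summable_norm
    (summable_norm_gf hf hz) (summable_norm_gf hh hz)]
  refine tsum_congr fun n => ?_
  rw [conv, ENNReal.toReal_sum fun x _ => ENNReal.mul_ne_top
    (ENNReal.ne_top_of_tsum_ne_top hf _) (ENNReal.ne_top_of_tsum_ne_top hh _)]
  push_cast
  rw [Finset.sum_mul]
  refine Finset.sum_congr rfl fun x hx => ?_
  rw [← Finset.HasAntidiagonal.mem_antidiagonal.1 hx, ENNReal.toReal_mul, pow_add]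
  push_cast
  ring

theorem tsum_conv (f h : ℕ → ℝ≥0∞) : ∑' n, conv f h n = (∑' n, f n) * ∑' n, h n := by
  simp only [conv]
  rw [← ENNReal.tsum_mul_right]
  simp only [← ENNReal.tsum_mul_left]
  rw [← ENNReal.tsum_prod (f := fun m x => f m * h x),
    ← Finset.HasAntidiagonal.sigmaAntidiagonalEquivProd.tsum_eq, ENNReal.tsum_sigma']
  refine tsum_congr fun n => ?_
  rw [tsum_fintype, ← Finset.sum_coe_sort]
  rfl

/-! ### The recursion in the remaining time of one activity. -/

namespace Model

variable (M : Model)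

theorem tsum_arrivalProb_ne_top : ∑' x, M.arrivalProb x ≠ ∞ := by
  rw [M.tsum_arrivalProb]
  exact ENNReal.one_ne_top

theorem arrivalProb_ne_top (x : ℕ) : M.arrivalProb x ≠ ∞ :=
  ENNReal.ne_top_of_tsum_ne_top M.tsum_arrivalProb_ne_top x

theorem gf_arrivalProb {z : ℂ} (hz : ‖z‖ ≤ 1) :
    gf M.arrivalProb z = (1 - M.lam : ℝ) + (M.lam : ℂ) * M.G z := by
  have h : ∑' n, M.g n * ENNReal.ofReal M.lam ≠ ∞ := by
    rw [ENNReal.tsum_mul_right, M.g.tsum_coe]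
    simp
  have h' : ∑' n : ℕ, (if n = 0 then ENNReal.ofReal (1 - M.lam) else 0) ≠ ∞ := by
    rw [tsum_ite_eq]
    simp
  have e : M.arrivalProb = fun n => (if n = 0 then ENNReal.ofReal (1 - M.lam) else 0) +
      M.g n * ENNReal.ofReal M.lam := by
    ext n
    rw [arrivalProb, mul_comm (M.g n)]
  rw [e, gf_add h' h hz, gf_mul_const, ENNReal.toReal_ofReal M.lam_pos.le, mul_comm _ (M.lam : ℂ)]
  congr 1
  rw [gf, tsum_eq_single 0]
  · rw [if_pos rfl, pow_zero, mul_one, ENNReal.toReal_ofReal (by linarith [M.lam_le_one])]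
  · intro n hn
    simp [hn]

/-- Reindexed by k = ℓ - 1, so that sums over `Finset.range` are those produced by iterating the
recursion. -/
theorem hasSum_zTransform (D : PMF ℕ+) {x : ℂ} (hx : ‖x‖ ≤ 1) :
    HasSum (fun k : ℕ => ((D k.succPNat).toReal : ℂ) * x ^ (k + 1)) (zTransform D x) := by
  have h : Summable fun l : ℕ+ => ((D l).toReal : ℂ) * x ^ (l : ℕ) := by
    refine Summable.of_norm_bounded (ENNReal.summable_toReal D.tsum_coe_ne_top) fun l => ?_
    rw [norm_mul, norm_pow, Complex.norm_real, Real.norm_of_nonneg ENNReal.toReal_nonneg]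
    exact mul_le_of_le_one_right ENNReal.toReal_nonneg (pow_le_one₀ (norm_nonneg _) hx)
  exact (Equiv.pnatEquivNat.symm.hasSum_iff (f := fun l : ℕ+ => ((D l).toReal : ℂ) * x ^ (l : ℕ))).2
    h.hasSum

section Activity

/-! An activity with duration law `D` starts at rate `s n` with `n` customers in the queue; `u n l`
is the stationary mass of the states in which it has `l` slots left and `n` customers wait. -/

variable {M} {u : ℕ → ℕ+ → ℝ≥0∞} {s : ℕ → ℝ≥0∞} {D : PMF ℕ+}

/-- The starts at queue length n contribute mass s_n ∑ D = s_n to the states with n waiting. -/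
theorem tsum_startRate_ne_top (hu : ∑' n, ∑' l, u n l ≠ ∞)
    (h : ∀ n l, u n l = conv (fun m => u m (l + 1)) M.arrivalProb n + s n * D l) :
    ∑' n, s n ≠ ∞ := by
  refine ne_top_of_le_ne_top hu (ENNReal.tsum_le_tsum fun n => ?_)
  calc s n = ∑' l, s n * D l := by rw [ENNReal.tsum_mul_left, D.tsum_coe, mul_one]
    _ ≤ ∑' l, u n l := ENNReal.tsum_le_tsum fun l => by
        rw [h n l]
        exact le_add_self

/-- Telescoping in the remaining time: each step towards completion multiplies by the generating
function x of one slot's arrivals, so a start with duration l contributes x^l. -/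
theorem gf_completionRate (hu : ∑' n, ∑' l, u n l ≠ ∞)
    (h : ∀ n l, u n l = conv (fun m => u m (l + 1)) M.arrivalProb n + s n * D l)
    {z : ℂ} (hz : ‖z‖ ≤ 1) :
    gf (conv (fun m => u m 1) M.arrivalProb) z = M.arrGF D z * gf s z := by
  have hs := tsum_startRate_ne_top hu h
  have hu' : ∑' l, ∑' n, u n l ≠ ∞ := by rwa [ENNReal.tsum_comm]
  have hl : ∀ l, ∑' n, u n l ≠ ∞ := ENNReal.ne_top_of_tsum_ne_top hu'
  set x : ℂ := (1 - M.lam : ℝ) + (M.lam : ℂ) * M.G z with hx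
  have hgx : gf M.arrivalProb z = x := M.gf_arrivalProb hz
  have hx1 : ‖x‖ ≤ 1 := by
    rw [← hgx]
    simpa [M.tsum_arrivalProb] using norm_gf_le M.tsum_arrivalProb_ne_top hz
  let φ : ℕ → ℂ := fun k => gf (fun n => u n k.succPNat) z
  have hφ : ∀ k, φ k = φ (k + 1) * x + (D k.succPNat).toReal * gf s z := by
    intro k
    have e : (fun n => u n k.succPNat) = fun n =>
        conv (fun m => u m (k + 1).succPNat) M.arrivalProb n + s n * D k.succPNat := by
      ext n
      exact h n _
    simp only [φ]
    rw [e, gf_add, gf_conv (hl _) M.tsum_arrivalProb_ne_top hz, gf_mul_const, hgx]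
    · ring
    · rw [tsum_conv]
      exact ENNReal.mul_ne_top (hl _) M.tsum_arrivalProb_ne_top
    · rw [ENNReal.tsum_mul_right]
      exact ENNReal.mul_ne_top hs (D.apply_ne_top _)
    · exact hz
  have hsum : ∀ k, φ 0 * x = φ k * x ^ (k + 1) +
      (∑ i ∈ Finset.range k, ((D i.succPNat).toReal : ℂ) * x ^ (i + 1)) * gf s z := by
    intro k
    induction k with
    | zero => simp
    | succ k ih =>
      rw [ih, hφ k, Finset.sum_range_succ]
      ring
  -- Since |x| = 1 is possible, the decay comes from the masses, which are summable over the
  -- remaining time.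
  have hlim : Filter.Tendsto (fun k => φ k * x ^ (k + 1)) Filter.atTop (nhds 0) := by
    have h1 : Filter.Tendsto (fun k : ℕ => (∑' n, u n k.succPNat).toReal) Filter.atTop
        (nhds 0) :=
      ((ENNReal.summable_toReal hu').comp_injective
        (i := Nat.succPNat) Nat.succPNat_injective).tendsto_atTop_zero
    refine squeeze_zero_norm (fun k => ?_) h1
    rw [norm_mul, norm_pow]
    exact (mul_le_of_le_one_right (norm_nonneg _) (pow_le_one₀ (norm_nonneg _) hx1)).trans
      (norm_gf_le (hl _) hz)
  have h2 := hlim.add (((hasSum_zTransform D hx1).tendsto_sum_nat).mul_const (gf s z))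
  rw [zero_add] at h2
  have h3 := tendsto_nhds_unique (h2.congr fun k => (hsum k).symm) tendsto_const_nhds
  rw [gf_conv (hl _) M.tsum_arrivalProb_ne_top hz, hgx]
  exact h3.symm

/-- By induction the mass at shorter queues vanishes, so u_n(l) equals u_n(l+1) times the
probability of no arrival. It is thus nondecreasing in l, yet summable. Only starts at queue lengths
up to n matter, which is what vacations require. -/
theorem eq_zero_of_startRate_eq_zero (hu : ∑' n, ∑' l, u n l ≠ ∞)
    (h : ∀ n l, u n l = conv (fun m => u m (l + 1)) M.arrivalProb n + s n * D l) (n : ℕ)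
    (hs : ∀ m ≤ n, s m = 0) (l : ℕ+) : u n l = 0 := by
  induction n using Nat.strong_induction_on generalizing l with
  | _ n ih =>
    have hle : ∀ l, u n l ≤ u n (l + 1) := by
      intro l
      rw [h n l, hs n le_rfl, zero_mul, add_zero, conv, Finset.sum_eq_single (n, 0)]
      · exact mul_le_of_le_one_right' (M.arrivalLaw.coe_le_one 0)
      · intro x hx hne
        have hx' := Finset.HasAntidiagonal.mem_antidiagonal.1 hx
        have : x.1 < n := by
          rcases x with ⟨i, j⟩
          simp only [ne_eq, Prod.mk.injEq] at hne hx' ⊢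
          omega
        rw [ih _ this (fun m hm => hs m (by omega)), zero_mul]
      · intro hx
        exact (hx (Finset.HasAntidiagonal.mem_antidiagonal.2 (add_zero n))).elim
    have hmono : Monotone fun k : ℕ => u n k.succPNat := monotone_nat_of_le_succ fun k => hle _
    have h0 : Filter.Tendsto (fun k : ℕ => u n k.succPNat) Filter.atTop (nhds 0) := by
      refine ENNReal.tendsto_atTop_zero_of_tsum_ne_top ?_
      exact ne_top_of_le_ne_top (ENNReal.ne_top_of_tsum_ne_top hu n)
        (ENNReal.tsum_comp_le_tsum_of_injective Nat.succPNat_injective _)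
    have := hmono.ge_of_tendsto h0 l.natPred
    simpa using this

end Activity

end Model

/-! ### The coefficients e_{n,i}. -/

namespace Model

variable {M : Model}

theorem e_self (M : Model) (n : ℕ) : M.e n n = 1 := by
  rw [e, if_pos le_rfl]

/-- The separate term g_{n-i} is the case j = n, by e_{n,n} = 1. Thus e_{n,i} is the renewal
probability that a queue growing by groups from i visits n, decomposed at its first jump. -/
theorem e_of_lt (M : Model) {n i : ℕ} (h : i < n) :
    M.e n i = ∑ j ∈ Finset.Ioc i n, M.e n j * M.gc (j - i) := by
  rw [e, if_neg (by omega), Finset.sum_coe_sort (Finset.Ioo i n) fun j => M.e n j * M.gc (j - i),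
    ← Finset.Ioo_insert_right h, Finset.sum_insert (by simp), e_self, one_mul, add_comm]

theorem e_add_add (M : Model) (n i k : ℕ) : M.e (n + k) (i + k) = M.e n i := by
  induction hd : n - i using Nat.strong_induction_on generalizing i with
  | _ d ih =>
    by_cases h : i < n
    · rw [M.e_of_lt h, M.e_of_lt (by omega : i + k < n + k), ← Finset.map_add_right_Ioc,
        Finset.sum_map]
      refine Finset.sum_congr rfl fun j hj => ?_
      rw [Finset.mem_Ioc] at hj
      rw [addRightEmbedding_apply, ih (n - j) (by omega) j rfl, Nat.add_sub_add_right]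
    · rw [e, if_pos (by omega), e, if_pos (by omega)]

/-- Decomposition at the last jump. Since e_{n,j} depends only on n - j, the reflection j ↦ n + l -
j exchanges first and last jump. -/
theorem e_eq_sum_Ico (M : Model) {n l : ℕ} (h : l < n) :
    M.e n l = ∑ m ∈ Finset.Ico l n, M.e m l * M.gc (n - m) := by
  rw [M.e_of_lt h]
  refine Finset.sum_nbij' (fun j => n + l - j) (fun m => n + l - m) ?_ ?_ ?_ ?_ ?_
  all_goals simp only [Finset.mem_Ioc, Finset.mem_Ico]
  any_goals (intros; omega)
  intro j hj
  have h1 := M.e_add_add (n + l - j) l (j - l)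
  rw [show n + l - j + (j - l) = n by omega, show l + (j - l) = j by omega] at h1
  rw [h1, show n - (n + l - j) = j - l by omega]

theorem arrivalProb_zero_toReal (M : Model) : (M.arrivalProb 0).toReal = 1 - M.lam := by
  rw [arrivalProb, M.g_zero, if_pos rfl, mul_zero, add_zero,
    ENNReal.toReal_ofReal (by linarith [M.lam_le_one])]

theorem arrivalProb_toReal (M : Model) {x : ℕ} (hx : x ≠ 0) :
    (M.arrivalProb x).toReal = M.lam * M.gc x := by
  rw [arrivalProb, if_neg hx, zero_add, ENNReal.toReal_mul, ENNReal.toReal_ofReal M.lam_pos.le, gc]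

theorem one_sub_delta (M : Model) : 1 - M.delta = if M.multiple then 0 else 1 := by
  rw [delta]
  split_ifs <;> norm_num

/-! ### Support, dormant masses and generating functions of a stationary measure. -/

namespace IsStationary

variable {P Q : State → ℝ≥0∞}

theorem ne_top (h : M.IsStationary P Q) (s : State) : P s ≠ ∞ :=
  ENNReal.ne_top_of_tsum_ne_top h.tsum_ne_top s

theorem ne_top' (h : M.IsStationary P Q) (s : State) : Q s ≠ ∞ :=
  ENNReal.ne_top_of_tsum_ne_top h.tsum_ne_top' s

theorem tsum_comp_ne_top (h : M.IsStationary P Q) {ι : Type*} {c : ι → State}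
    (hc : Function.Injective c) : ∑' i, P (c i) ≠ ∞ :=
  ne_top_of_le_ne_top h.tsum_ne_top (ENNReal.tsum_comp_le_tsum_of_injective hc P)

theorem tsum_comp_ne_top' (h : M.IsStationary P Q) {ι : Type*} {c : ι → State}
    (hc : Function.Injective c) : ∑' i, Q (c i) ≠ ∞ :=
  ne_top_of_le_ne_top h.tsum_ne_top' (ENNReal.tsum_comp_le_tsum_of_injective hc Q)

theorem tsum_activity_ne_top (h : M.IsStationary P Q) {c : ℕ → ℕ+ → State}
    (hc : Function.Injective2 c) : ∑' n, ∑' l, P (c n l) ≠ ∞ := by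
  rw [← ENNReal.tsum_prod (f := fun n l => P (c n l))]
  exact h.tsum_comp_ne_top (c := fun x : ℕ × ℕ+ => c x.1 x.2) hc.uncurry

theorem tsum_fes_ne_top (h : M.IsStationary P Q) (r : ℕ) : ∑' n, ∑' l, P (.fes n r l) ≠ ∞ :=
  h.tsum_activity_ne_top (c := fun n l => .fes n r l) fun _ _ _ _ e => by simpa using e

theorem tsum_sos_ne_top (h : M.IsStationary P Q) (j : ℕ) : ∑' n, ∑' l, P (.sos n j l) ≠ ∞ :=
  h.tsum_activity_ne_top (c := fun n l => .sos n j l) fun _ _ _ _ e => by simpa using e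

theorem tsum_vac_ne_top (h : M.IsStationary P Q) (k : ℕ) : ∑' n, ∑' l, P (.vac n k l) ≠ ∞ :=
  h.tsum_activity_ne_top (c := fun n l => .vac n k l) fun _ _ _ _ e => by simpa using e

theorem tsum_fes_ne_top' (h : M.IsStationary P Q) (r : ℕ) (l : ℕ+) :
    ∑' n, Q (.fes n r l) ≠ ∞ :=
  h.tsum_comp_ne_top' (c := fun n => .fes n r l) fun _ _ e => by simpa using e

theorem tsum_sos_ne_top' (h : M.IsStationary P Q) (j : ℕ) (l : ℕ+) :
    ∑' n, Q (.sos n j l) ≠ ∞ :=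
  h.tsum_comp_ne_top' (c := fun n => .sos n j l) fun _ _ e => by simpa using e

theorem tsum_vac_ne_top' (h : M.IsStationary P Q) (k : ℕ) (l : ℕ+) :
    ∑' n, Q (.vac n k l) ≠ ∞ :=
  h.tsum_comp_ne_top' (c := fun n => .vac n k l) fun _ _ e => by simpa using e

theorem tsum_dormant_ne_top' (h : M.IsStationary P Q) : ∑' n, Q (.dormant n) ≠ ∞ :=
  h.tsum_comp_ne_top' (c := .dormant) fun _ _ e => by simpa using e

theorem fes_eq_conv (h : M.IsStationary P Q) (r n : ℕ) (l : ℕ+) : P (.fes n r l) =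
    conv (fun m => P (.fes m r (l + 1))) M.arrivalProb n + M.fesRate Q n r * M.S r l := by
  rw [h.fes_bal, h.fes_arr, conv]

theorem sos_eq_conv (h : M.IsStationary P Q) (j n : ℕ) (l : ℕ+) : P (.sos n j l) =
    conv (fun m => P (.sos m j (l + 1))) M.arrivalProb n +
    (if j = 0 then 0 else ∑' r, Q (.fes n r 1) * ENNReal.ofReal (M.chi r j)) * M.SO j l := by
  rw [h.sos_bal, h.sos_arr, conv]

theorem vac_eq_conv (h : M.IsStationary P Q) (k n : ℕ) (l : ℕ+) : P (.vac n k l) =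
    conv (fun m => P (.vac m k (l + 1))) M.arrivalProb n +
    (if n = k ∧ k < M.a then M.batchRate Q n + (if M.multiple then vacRate Q n else 0) else 0) *
      M.V k l := by
  rw [h.vac_bal, h.vac_arr, conv]

/-- The initial law may charge batch sizes that never start; stationary mass cannot stay there. -/
theorem fes_eq_zero (h : M.IsStationary P Q) {r : ℕ} (hr : r ∉ Finset.Icc M.a M.b) (n : ℕ)
    (l : ℕ+) : Q (.fes n r l) = 0 := by
  have hP : ∀ m l, P (.fes m r l) = 0 := fun m l =>
    eq_zero_of_startRate_eq_zero (h.tsum_fes_ne_top r) (h.fes_eq_conv r) m (fun n _ => by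
      rw [fesRate, ENNReal.tsum_eq_zero]
      intro m
      have := M.a_le_b
      rw [Finset.mem_Icc] at hr
      rw [if_neg (by omega), mul_zero]) l
  simp [h.fes_arr, hP]

theorem sos_eq_zero (h : M.IsStationary P Q) {j : ℕ} (hj : j ∉ Finset.Icc 1 M.b) (n : ℕ)
    (l : ℕ+) : Q (.sos n j l) = 0 := by
  have hP : ∀ m l, P (.sos m j l) = 0 := fun m l =>
    eq_zero_of_startRate_eq_zero (h.tsum_sos_ne_top j) (h.sos_eq_conv j) m (fun n _ => by
      rw [ite_eq_left_iff]
      intro hj0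
      rw [ENNReal.tsum_eq_zero]
      intro r
      by_cases hr : r ∈ Finset.Icc M.a M.b
      · rw [Finset.mem_Icc] at hr hj
        -- Here j > b ≥ r, and more than r customers cannot opt for the SOS.
        rw [M.chi_of_lt (by omega), ENNReal.ofReal_zero, mul_zero]
      · rw [h.fes_eq_zero hr, zero_mul]) l
  simp [h.sos_arr, hP]

/-- A vacation of type k starts only with k < a customers waiting, and the queue does not shrink
during it. -/
theorem vac_eq_zero (h : M.IsStationary P Q) {n k : ℕ} (hk : ¬ (k < M.a ∧ k ≤ n)) (l : ℕ+) :
    Q (.vac n k l) = 0 := by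
  have hP : ∀ m ≤ n, ∀ l, P (.vac m k l) = 0 := fun m hm l =>
    eq_zero_of_startRate_eq_zero (h.tsum_vac_ne_top k) (h.vac_eq_conv k) m
      (fun n _ => if_neg (by omega)) l
  rw [h.vac_arr]
  refine Finset.sum_eq_zero fun x hx => ?_
  have := Finset.HasAntidiagonal.mem_antidiagonal.1 hx
  rw [hP _ (by omega), zero_mul]

theorem batchRate_eq (h : M.IsStationary P Q) (n : ℕ) : M.batchRate Q n =
    ∑ r ∈ Finset.Icc M.a M.b, Q (.fes n r 1) * ENNReal.ofReal (M.chi r 0) +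
      ∑ j ∈ Finset.Icc 1 M.b, Q (.sos n j 1) := by
  rw [batchRate, tsum_eq_sum fun r hr => by rw [h.fes_eq_zero hr, zero_mul],
    tsum_eq_sum fun j hj => h.sos_eq_zero hj n 1]

theorem vacRate_eq (h : M.IsStationary P Q) (n : ℕ) :
    vacRate Q n = ∑ k ∈ Finset.range M.a, Q (.vac n k 1) :=
  tsum_eq_sum fun k hk => h.vac_eq_zero (by rw [Finset.mem_range] at hk; omega) 1

theorem vacRate_eq' (h : M.IsStationary P Q) (n : ℕ) :
    vacRate Q n = ∑ k ∈ Finset.range (n + 1), Q (.vac n k 1) :=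
  tsum_eq_sum fun k hk => h.vac_eq_zero (by rw [Finset.mem_range] at hk; omega) 1

theorem tsum_fes_mul_ne_top (h : M.IsStationary P Q) (r j : ℕ) :
    ∑' n, Q (.fes n r 1) * ENNReal.ofReal (M.chi r j) ≠ ∞ := by
  rw [ENNReal.tsum_mul_right]
  exact ENNReal.mul_ne_top (h.tsum_fes_ne_top' r 1) ENNReal.ofReal_ne_top

theorem tsum_sum_ne_top {ι : Type*} {s : Finset ι} {f : ι → ℕ → ℝ≥0∞}
    (hf : ∀ i ∈ s, ∑' n, f i n ≠ ∞) : ∑' n, ∑ i ∈ s, f i n ≠ ∞ := by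
  rw [Summable.tsum_finsetSum fun _ _ => ENNReal.summable]
  exact ENNReal.sum_ne_top.2 hf

theorem tsum_batchRate_ne_top (h : M.IsStationary P Q) : ∑' n, M.batchRate Q n ≠ ∞ := by
  simp only [h.batchRate_eq]
  rw [ENNReal.tsum_add]
  exact ENNReal.add_ne_top.2 ⟨tsum_sum_ne_top fun r _ => h.tsum_fes_mul_ne_top r 0,
    tsum_sum_ne_top fun j _ => h.tsum_sos_ne_top' j 1⟩

theorem tsum_vacRate_ne_top (h : M.IsStationary P Q) : ∑' n, vacRate Q n ≠ ∞ := by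
  simp only [h.vacRate_eq]
  exact tsum_sum_ne_top fun j _ => h.tsum_vac_ne_top' j 1

theorem batchRate_ne_top (h : M.IsStationary P Q) (n : ℕ) : M.batchRate Q n ≠ ∞ :=
  ENNReal.ne_top_of_tsum_ne_top h.tsum_batchRate_ne_top n

theorem vacRate_ne_top (h : M.IsStationary P Q) (n : ℕ) : vacRate Q n ≠ ∞ :=
  ENNReal.ne_top_of_tsum_ne_top h.tsum_vacRate_ne_top n

theorem dormant_arr_toReal (h : M.IsStationary P Q) (n : ℕ) : (Q (.dormant n)).toReal =
    ∑ m ∈ Finset.range n, (P (.dormant m)).toReal * (M.lam * M.gc (n - m)) +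
      (P (.dormant n)).toReal * (1 - M.lam) := by
  rw [h.dormant_arr, Finset.Nat.sum_antidiagonal_eq_sum_range_succ_mk, ENNReal.toReal_sum
    fun m _ => ENNReal.mul_ne_top (h.ne_top _) (M.arrivalProb_ne_top _), Finset.sum_range_succ]
  congr 1
  · refine Finset.sum_congr rfl fun m hm => ?_
    rw [Finset.mem_range] at hm
    rw [ENNReal.toReal_mul, M.arrivalProb_toReal (by omega)]
  · rw [ENNReal.toReal_mul, Nat.sub_self, M.arrivalProb_zero_toReal]

/-- Balance at a dormant state n < a: after cancelling the slots without arrivals, λP_n is the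
inflow from lower dormant states plus, under single vacations, from vacations ending at n. This
renewal recursion is solved by the e_{n,l}; under multiple vacations it forces the mass to be zero.
-/
theorem dormant_eq (h : M.IsStationary P Q) {n : ℕ} (hn : n < M.a) :
    M.lam * (P (.dormant n)).toReal =
      (1 - M.delta) * ∑ l ∈ Finset.range (n + 1), (vacRate Q l).toReal * M.e n l := by
  induction n using Nat.strong_induction_on with
  | _ n ih =>
    have h1 : (P (.dormant n)).toReal =
        (Q (.dormant n)).toReal + (1 - M.delta) * (vacRate Q n).toReal := by
      conv_lhs => rw [h.dormant_bal, if_pos hn]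
      rw [one_sub_delta]
      split_ifs
      · simp
      · rw [one_mul, ENNReal.toReal_add (h.ne_top' _) (h.vacRate_ne_top n)]
    have h2 : ∑ m ∈ Finset.range n, (P (.dormant m)).toReal * (M.lam * M.gc (n - m)) =
        (1 - M.delta) * ∑ l ∈ Finset.range n, (vacRate Q l).toReal * M.e n l := by
      calc _ = ∑ m ∈ Finset.range n, ∑ l ∈ Finset.range (m + 1),
            (1 - M.delta) * ((vacRate Q l).toReal * (M.e m l * M.gc (n - m))) := by
              refine Finset.sum_congr rfl fun m hm => ?_
              rw [Finset.mem_range] at hm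
              rw [← mul_assoc, mul_comm _ M.lam, ih m hm (by omega), mul_assoc, Finset.sum_mul,
                Finset.mul_sum]
              refine Finset.sum_congr rfl fun l _ => by ring
        _ = ∑ l ∈ Finset.range n, ∑ m ∈ Finset.Ico l n,
            (1 - M.delta) * ((vacRate Q l).toReal * (M.e m l * M.gc (n - m))) :=
              Finset.sum_comm' fun m l => by simp only [Finset.mem_range, Finset.mem_Ico]; omega
        _ = _ := by
              rw [Finset.mul_sum]
              refine Finset.sum_congr rfl fun l hl => ?_
              rw [M.e_eq_sum_Ico (Finset.mem_range.1 hl), Finset.mul_sum, Finset.mul_sum]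
    rw [h.dormant_arr_toReal, h2] at h1
    rw [Finset.sum_range_succ, e_self]
    linear_combination h1

/-- At t- no dormant state has a or more customers, so such a queue after arrivals comes from one
jump out of a dormant state j < a. -/
theorem dormant_arr_eq (h : M.IsStationary P Q) {n : ℕ} (hn : M.a ≤ n) :
    (Q (.dormant n)).toReal = (1 - M.delta) * ∑ l ∈ Finset.range M.a,
      (vacRate Q l).toReal * ∑ j ∈ Finset.Ico l M.a, M.e j l * M.gc (n - j) := by
  have h0 : ∀ m, M.a ≤ m → P (.dormant m) = 0 := fun m hm => by
    rw [h.dormant_bal, if_neg (by omega)]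
  rw [h.dormant_arr_toReal, h0 n hn, ENNReal.toReal_zero, zero_mul, add_zero,
    ← Finset.sum_subset (Finset.range_mono hn) fun m _ hm => by
      rw [h0 m (by simpa using hm), ENNReal.toReal_zero, zero_mul]]
  calc _ = ∑ m ∈ Finset.range M.a, ∑ l ∈ Finset.range (m + 1),
        (1 - M.delta) * ((vacRate Q l).toReal * (M.e m l * M.gc (n - m))) := by
          refine Finset.sum_congr rfl fun m hm => ?_
          rw [← mul_assoc, mul_comm _ M.lam, h.dormant_eq (Finset.mem_range.1 hm), mul_assoc,
            Finset.sum_mul, Finset.mul_sum]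
          refine Finset.sum_congr rfl fun l _ => by ring
    _ = ∑ l ∈ Finset.range M.a, ∑ m ∈ Finset.Ico l M.a,
        (1 - M.delta) * ((vacRate Q l).toReal * (M.e m l * M.gc (n - m))) :=
          Finset.sum_comm' fun m l => by simp only [Finset.mem_range, Finset.mem_Ico]; omega
    _ = _ := by
          rw [Finset.mul_sum]
          refine Finset.sum_congr rfl fun l hl => ?_
          rw [Finset.mul_sum, Finset.mul_sum]

/-- If no service and no vacation is ever completed, then `P` is the zero measure. -/
theorem eq_zero_of_completing (h : M.IsStationary P Q) (hQ : ∀ s ∈ completing, Q s = 0) :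
    ∑' s, P s = 0 := by
  have hf : ∀ n r, Q (.fes n r 1) = 0 := fun n r => hQ _ rfl
  have hs : ∀ n r, Q (.sos n r 1) = 0 := fun n r => hQ _ rfl
  have hv : ∀ n r, Q (.vac n r 1) = 0 := fun n r => hQ _ rfl
  have hB : ∀ n, M.batchRate Q n = 0 := fun n => by simp [batchRate, hf, hs]
  have hV : ∀ n, vacRate Q n = 0 := fun n => by simp [vacRate, hv]
  -- Dormant queues that reach a start an FES, so they must be excluded first; this uses λ > 0.
  have hd : ∀ n, P (.dormant n) = 0 := fun n => by
    by_cases hn : n < M.a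
    · have h1 := h.dormant_eq hn
      simp only [hV, ENNReal.toReal_zero, zero_mul, Finset.sum_const_zero, mul_zero,
        mul_eq_zero, M.lam_pos.ne', false_or] at h1
      exact (ENNReal.toReal_eq_zero_iff _).1 h1 |>.resolve_right (h.ne_top _)
    · rw [h.dormant_bal, if_neg hn]
  have hd' : ∀ n, Q (.dormant n) = 0 := fun n => by simp [h.dormant_arr, hd]
  have h1 : ∀ n r l, P (.fes n r l) = 0 := fun n r =>
    eq_zero_of_startRate_eq_zero (h.tsum_fes_ne_top r) (h.fes_eq_conv r) n fun n _ => by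
      simp [fesRate, hB, hV, hd']
  have h2 : ∀ n j l, P (.sos n j l) = 0 := fun n j =>
    eq_zero_of_startRate_eq_zero (h.tsum_sos_ne_top j) (h.sos_eq_conv j) n fun n _ => by
      simp [hf]
  have h3 : ∀ n k l, P (.vac n k l) = 0 := fun n k =>
    eq_zero_of_startRate_eq_zero (h.tsum_vac_ne_top k) (h.vac_eq_conv k) n fun n _ => by
      simp [hB, hV]
  simp [State.tsum_eq, hd, h1, h2, h3]

theorem gf_fes (h : M.IsStationary P Q) (r : ℕ) {z : ℂ} (hz : ‖z‖ ≤ 1) :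
    gf (fun n => Q (.fes n r 1)) z = M.K r z * gf (fun n => M.fesRate Q n r) z := by
  rw [K, ← gf_completionRate (h.tsum_fes_ne_top r) (h.fes_eq_conv r) hz]
  simp only [h.fes_arr]
  rfl

/-- A batch smaller than b takes the whole queue. -/
theorem fesRate_of_lt {r : ℕ} (hr : r ∈ Finset.Ico M.a M.b) (n : ℕ) : M.fesRate Q n r =
    if n = 0 then Q (.dormant r) + M.batchRate Q r + vacRate Q r else 0 := by
  rw [Finset.mem_Ico] at hr
  rw [fesRate, tsum_eq_single r]
  · split_ifs <;> first | omega | simp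
  · intro m hm
    rw [if_neg (by omega), mul_zero]

theorem fesRate_b (n : ℕ) : M.fesRate Q n M.b =
    Q (.dormant (n + M.b)) + M.batchRate Q (n + M.b) + vacRate Q (n + M.b) := by
  have := M.a_le_b
  rw [fesRate, tsum_eq_single (n + M.b)]
  · rw [if_pos (by omega), mul_one]
  · intro m hm
    rw [if_neg (by omega), mul_zero]

theorem gf_fes_of_lt (h : M.IsStationary P Q) {r : ℕ} (hr : r ∈ Finset.Ico M.a M.b) {z : ℂ}
    (hz : ‖z‖ ≤ 1) : gf (fun n => Q (.fes n r 1)) z = M.K r z *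
      ((M.batchRate Q r).toReal + (vacRate Q r).toReal + (Q (.dormant r)).toReal) := by
  rw [h.gf_fes r hz]
  simp only [fesRate_of_lt hr]
  congr 1
  rw [gf, tsum_eq_single 0]
  · rw [if_pos rfl, pow_zero, mul_one, ENNReal.toReal_add
      (ENNReal.add_ne_top.2 ⟨h.ne_top' _, h.batchRate_ne_top r⟩) (h.vacRate_ne_top r),
      ENNReal.toReal_add (h.ne_top' _) (h.batchRate_ne_top r)]
    push_cast
    ring
  · intro n hn
    simp [hn]

/-- The starts of an SOS of size j are the FES completions weighted by χ_{r,j}. -/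
theorem gf_sos (h : M.IsStationary P Q) {j : ℕ} (hj : j ≠ 0) {z : ℂ} (hz : ‖z‖ ≤ 1) :
    gf (fun n => Q (.sos n j 1)) z =
      M.T j z * ∑ r ∈ Finset.Icc M.a M.b, gf (fun n => Q (.fes n r 1)) z * M.chi r j := by
  have e : (fun n => Q (.sos n j 1)) = conv (fun n => P (.sos n j 1)) M.arrivalProb := by
    ext n
    rw [h.sos_arr, conv]
  rw [e, gf_completionRate (h.tsum_sos_ne_top j) (h.sos_eq_conv j) hz, T]
  congr 1
  simp only [hj, if_false]
  have e' : (fun n => ∑' r, Q (.fes n r 1) * ENNReal.ofReal (M.chi r j)) = fun n =>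
      ∑ r ∈ Finset.Icc M.a M.b, Q (.fes n r 1) * ENNReal.ofReal (M.chi r j) := by
    ext n
    exact tsum_eq_sum fun r hr => by rw [h.fes_eq_zero hr, zero_mul]
  rw [e', gf_sum _ (fun r _ => h.tsum_fes_mul_ne_top r j) hz]
  refine Finset.sum_congr rfl fun r _ => ?_
  rw [gf_mul_const, ENNReal.toReal_ofReal (M.chi_nonneg r j)]

/-- Vacations of type k start only at queue length k, so their starts form a monomial. -/
theorem gf_vac (h : M.IsStationary P Q) {k : ℕ} (hk : k < M.a) {z : ℂ} (hz : ‖z‖ ≤ 1) :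
    gf (fun n => Q (.vac n k 1)) z = M.H k z *
      (((M.batchRate Q k).toReal + M.delta * (vacRate Q k).toReal : ℝ) * z ^ k) := by
  have e : (fun n => Q (.vac n k 1)) = conv (fun n => P (.vac n k 1)) M.arrivalProb := by
    ext n
    rw [h.vac_arr, conv]
  rw [e, gf_completionRate (h.tsum_vac_ne_top k) (h.vac_eq_conv k) hz, H]
  congr 1
  rw [gf, tsum_eq_single k]
  · rw [if_pos ⟨rfl, hk⟩, delta]
    split_ifs
    · rw [ENNReal.toReal_add (h.batchRate_ne_top k) (h.vacRate_ne_top k), one_mul]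
    · simp
  · intro n hn
    simp [hn]

end IsStationary
end Model

/-! ### Tail series and rearrangement of the numerators. -/

theorem sum_Icc_eq_sum_Ico_add {a b : ℕ} (h : a ≤ b) (f : ℕ → ℂ) :
    ∑ i ∈ Finset.Icc a b, f i = ∑ i ∈ Finset.Ico a b, f i + f b := by
  rw [← Finset.Ico_insert_right h, Finset.sum_insert Finset.right_notMem_Ico, add_comm]

theorem gf_eq_sum_add {f : ℕ → ℝ≥0∞} (hf : ∑' n, f n ≠ ∞) {z : ℂ} (hz : ‖z‖ ≤ 1) (b : ℕ) :
    gf f z = ∑ n ∈ Finset.range b, ((f n).toReal : ℂ) * z ^ n +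
      z ^ b * gf (fun n => f (n + b)) z := by
  rw [gf, ← (summable_gf hf hz).sum_add_tsum_nat_add b, gf, ← tsum_mul_left]
  congr 1
  refine tsum_congr fun n => ?_
  ring

theorem tsum_nat_add_ne_top {f : ℕ → ℝ≥0∞} (hf : ∑' n, f n ≠ ∞) (b : ℕ) :
    ∑' n, f (n + b) ≠ ∞ :=
  ne_top_of_le_ne_top hf (ENNReal.tsum_comp_le_tsum_of_injective (add_left_injective b) f)

namespace Model

variable {M : Model}

/-- The substitution i = n + 1 + b - j gives the tails the same powers of z for all j, so they can
be combined termwise. -/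
theorem hasSum_gTail {j : ℕ} (hj : j ≤ M.b) {z : ℂ} (hz : ‖z‖ ≤ 1) :
    HasSum (fun n : ℕ => (M.gc (n + 1 + M.b - j) : ℂ) * z ^ (n + 1 + M.b)) (M.gTail j z) := by
  have hs : Summable fun i : ℕ =>
      if M.b + 1 - j ≤ i then (M.gc i : ℂ) * z ^ (i + j) else 0 := by
    refine Summable.of_norm_bounded (ENNReal.summable_toReal M.g.tsum_coe_ne_top) fun i => ?_
    split_ifs
    · rw [norm_mul, norm_pow, Complex.norm_real, gc, Real.norm_of_nonneg ENNReal.toReal_nonneg]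
      exact mul_le_of_le_one_right ENNReal.toReal_nonneg (pow_le_one₀ (norm_nonneg _) hz)
    · simp
  have h := (hasSum_nat_add_iff' (M.b + 1 - j)).2 hs.hasSum
  rw [Finset.sum_eq_zero fun i hi => if_neg (by rw [Finset.mem_range] at hi; omega),
    sub_zero] at h
  refine h.congr_fun fun n => ?_
  rw [if_pos (by omega), show n + (M.b + 1 - j) = n + 1 + M.b - j by omega,
    show n + 1 + M.b - j + j = n + 1 + M.b by omega]

/-- The index of F is shifted so that it refers to batches of size r. The range of y extends to b
because χ_{r,y} = 0 for y > r. -/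
theorem F_eq {r : ℕ} (hr : r ∈ Finset.Icc M.a M.b) (z₁ z₂ : ℂ) : M.F (r - M.a + 1) z₁ z₂ =
    ∑ y ∈ Finset.Icc 1 M.b, (M.chi r y : ℂ) * z₂ ^ y * M.T y z₁ := by
  rw [Finset.mem_Icc] at hr
  rw [F, show M.a + (r - M.a + 1) - 1 = r by omega]
  refine Finset.sum_subset (Finset.Icc_subset_Icc le_rfl hr.2) fun y _ hy => ?_
  rw [Finset.mem_Icc] at hy
  by_cases h : r < y
  · rw [M.chi_of_lt h, Complex.ofReal_zero, zero_mul, zero_mul]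
  · simp_all

/-- The generating function `χ_{n,0} + F_{n-a+1}(z, 1)`. -/
noncomputable def Qn (M : Model) (n : ℕ) (z : ℂ) : ℂ := M.chi n 0 + M.F (n - M.a + 1) z 1

theorem Qn_eq {r : ℕ} (hr : r ∈ Finset.Icc M.a M.b) (z : ℂ) :
    M.Qn r z = M.chi r 0 + ∑ y ∈ Finset.Icc 1 M.b, (M.chi r y : ℂ) * M.T y z := by
  simp only [Qn, F_eq hr, one_pow, mul_one]

/-- The weighted sum `(1-δ_p) ∑_{n<a} Γ_n ∑_{j=n}^{a-1} e_{j,n} φ_j`, as a linear form. -/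
noncomputable def dormantForm (M : Model) (π : PMF State) : (ℕ → ℂ) →ₗ[ℂ] ℂ :=
  ∑ n ∈ Finset.range M.a, (((1 - M.delta : ℝ) : ℂ) * M.Gam π n) •
    ∑ j ∈ Finset.Ico n M.a, (M.e j n : ℂ) • LinearMap.proj j

theorem dormantForm_apply (π : PMF State) (φ : ℕ → ℂ) : M.dormantForm π φ =
    ∑ n ∈ Finset.range M.a, ((1 - M.delta : ℝ) : ℂ) * M.Gam π n *
      ∑ j ∈ Finset.Ico n M.a, (M.e j n : ℂ) * φ j := by
  simp [dormantForm]

variable {π : PMF State}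

theorem D_eq (hΓ : ∀ n < M.a, ∑ k ∈ Finset.range (n + 1), M.gamma π n k = M.Gam π n) (i : ℕ) :
    (M.D π i : ℂ) = M.dormantForm π fun j => (M.gc (i - j) : ℂ) := by
  rw [dormantForm_apply, D, Complex.ofReal_mul, Complex.ofReal_sum, Finset.mul_sum]
  refine Finset.sum_congr rfl fun n hn => ?_
  rw [← Finset.sum_mul, hΓ n (Finset.mem_range.1 hn)]
  push_cast
  ring

/-- The group-size terms enter only through a linear form in j, whose value at g_{i-j} is D_i.
Linearity turns those with i < b into multiples of 𝒟; the rest joins the bracket that will be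
identified with 𝒟Y. -/
theorem numP_eq (hΓ : ∀ n < M.a, ∑ k ∈ Finset.range (n + 1), M.gamma π n k = M.Gam π n)
    (z₁ z₂ : ℂ) : M.numP π z₁ z₂ =
    (∑ i ∈ Finset.Ico M.a M.b, M.K i z₁ *
      (M.A π i + M.Gam π i + M.D π i : ℝ) * z₂ ^ i) * M.den z₁ +
    M.K M.b z₁ * z₂ ^ M.b * (M.D π M.b * z₁ ^ M.b + M.dormantForm π (fun j => M.gTail j z₁) +
      ∑ n ∈ Finset.range M.a, (M.A π n + M.delta * M.Gam π n : ℝ) * z₁ ^ n * M.H n z₁ +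
      ∑ n ∈ Finset.Ico M.a M.b, M.K n z₁ * (M.A π n + M.Gam π n + M.D π n : ℝ) * M.Qn n z₁ -
      ∑ n ∈ Finset.range M.b, (M.A π n + M.Gam π n : ℝ) * z₁ ^ n) := by
  have h1 : ∑ n ∈ Finset.range M.a,
      ((1 - M.delta : ℝ) * (∑ k ∈ Finset.range (n + 1), M.gamma π n k : ℝ) *
        ∑ j ∈ Finset.Ico n M.a, (M.e j n : ℂ) *
          (∑ i ∈ Finset.Icc M.a M.b, (M.gc (i - j) : ℂ) * M.K i z₁ * z₂ ^ i * z₁ ^ M.b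
            + M.gTail j z₁ * M.K M.b z₁ * z₂ ^ M.b
            - ∑ i ∈ Finset.Ico M.a M.b, (M.gc (i - j) : ℂ) * M.K i z₁ * z₂ ^ i *
                (M.chi M.b 0 + M.F (M.b - M.a + 1) z₁ 1) * M.K M.b z₁)) =
      M.dormantForm π (∑ i ∈ Finset.Ico M.a M.b,
        (M.K i z₁ * z₂ ^ i * M.den z₁) • (fun j => (M.gc (i - j) : ℂ)) +
        (M.K M.b z₁ * z₂ ^ M.b * z₁ ^ M.b) • (fun j => (M.gc (M.b - j) : ℂ)) +
        (M.K M.b z₁ * z₂ ^ M.b) • fun j => M.gTail j z₁) := by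
    rw [dormantForm_apply]
    refine Finset.sum_congr rfl fun n hn => ?_
    rw [hΓ n (Finset.mem_range.1 hn)]
    congr 1
    refine Finset.sum_congr rfl fun j _ => ?_
    simp only [Pi.add_apply, Pi.smul_apply, Finset.sum_apply, smul_eq_mul]
    rw [sum_Icc_eq_sum_Ico_add M.a_le_b]
    have : ∑ i ∈ Finset.Ico M.a M.b, M.K i z₁ * z₂ ^ i * M.den z₁ * (M.gc (i - j) : ℂ) =
        ∑ i ∈ Finset.Ico M.a M.b, (M.gc (i - j) : ℂ) * M.K i z₁ * z₂ ^ i * z₁ ^ M.b -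
        ∑ i ∈ Finset.Ico M.a M.b, (M.gc (i - j) : ℂ) * M.K i z₁ * z₂ ^ i *
          (M.chi M.b 0 + M.F (M.b - M.a + 1) z₁ 1) * M.K M.b z₁ := by
      rw [← Finset.sum_sub_distrib]
      refine Finset.sum_congr rfl fun i _ => ?_
      rw [den]
      ring
    rw [this]
    ring
  have h2 : M.dormantForm π (∑ i ∈ Finset.Ico M.a M.b,
        (M.K i z₁ * z₂ ^ i * M.den z₁) • (fun j => (M.gc (i - j) : ℂ)) +
        (M.K M.b z₁ * z₂ ^ M.b * z₁ ^ M.b) • (fun j => (M.gc (M.b - j) : ℂ)) +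
        (M.K M.b z₁ * z₂ ^ M.b) • fun j => M.gTail j z₁) =
      ∑ i ∈ Finset.Ico M.a M.b, M.K i z₁ * z₂ ^ i * M.den z₁ * M.D π i +
        M.K M.b z₁ * z₂ ^ M.b * z₁ ^ M.b * M.D π M.b +
        M.K M.b z₁ * z₂ ^ M.b * M.dormantForm π fun j => M.gTail j z₁ := by
    simp only [map_add, map_sum, map_smul, ← D_eq hΓ, smul_eq_mul]
  have h3 : ∑ n ∈ Finset.Ico M.a M.b,
      ((M.A π n + M.Gam π n : ℝ) * z₂ ^ n * M.K n z₁ * M.den z₁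
        + M.K M.b z₁ * z₂ ^ M.b *
          (M.K n z₁ * (M.A π n + M.Gam π n + M.D π n : ℝ) *
              (M.chi n 0 + M.F (n - M.a + 1) z₁ 1)
            - (M.A π n + M.Gam π n : ℝ) * z₁ ^ n)) =
      (∑ i ∈ Finset.Ico M.a M.b, M.K i z₁ *
        (M.A π i + M.Gam π i + M.D π i : ℝ) * z₂ ^ i) * M.den z₁ -
      -- Subtracted here because the dormant part already contributes these D_i terms.
      ∑ i ∈ Finset.Ico M.a M.b, M.K i z₁ * z₂ ^ i * M.den z₁ * M.D π i +
      M.K M.b z₁ * z₂ ^ M.b * (∑ n ∈ Finset.Ico M.a M.b,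
        M.K n z₁ * (M.A π n + M.Gam π n + M.D π n : ℝ) * M.Qn n z₁ -
        ∑ n ∈ Finset.Ico M.a M.b, (M.A π n + M.Gam π n : ℝ) * z₁ ^ n) := by
    rw [← Finset.sum_sub_distrib, Finset.sum_mul, Finset.mul_sum, ← Finset.sum_sub_distrib,
      ← Finset.sum_add_distrib]
    refine Finset.sum_congr rfl fun n _ => ?_
    rw [Qn]
    push_cast
    ring
  have h4 : ∑ n ∈ Finset.range M.a, (M.A π n + M.delta * M.Gam π n : ℝ) * z₁ ^ n * M.H n z₁ *
        M.K M.b z₁ * z₂ ^ M.b = M.K M.b z₁ * z₂ ^ M.b *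
      ∑ n ∈ Finset.range M.a, (M.A π n + M.delta * M.Gam π n : ℝ) * z₁ ^ n * M.H n z₁ := by
    rw [Finset.mul_sum]
    exact Finset.sum_congr rfl fun n _ => by ring
  have h5 : ∑ n ∈ Finset.range M.a, (M.A π n + M.Gam π n : ℝ) * z₁ ^ n *
        M.K M.b z₁ * z₂ ^ M.b = M.K M.b z₁ * z₂ ^ M.b *
      ∑ n ∈ Finset.range M.a, (M.A π n + M.Gam π n : ℝ) * z₁ ^ n := by
    rw [Finset.mul_sum]
    exact Finset.sum_congr rfl fun n _ => by ring
  rw [numP, Finset.sum_sub_distrib, Finset.sum_add_distrib, h1, h2, h3, h4, h5,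
    ← Finset.sum_range_add_sum_Ico _ M.a_le_b]
  ring

/-- The bracket is that of `numP_eq`; z₂^r is replaced by F_{r-a+1}(z₁, z₂), which accounts for the
SOS. -/
theorem numD_eq (hΓ : ∀ n < M.a, ∑ k ∈ Finset.range (n + 1), M.gamma π n k = M.Gam π n)
    (z₁ z₂ : ℂ) : M.numD π z₁ z₂ =
    (∑ i ∈ Finset.Ico M.a M.b, M.K i z₁ *
      (M.A π i + M.Gam π i + M.D π i : ℝ) * M.F (i - M.a + 1) z₁ z₂) * M.den z₁ +
    M.K M.b z₁ * M.F (M.b - M.a + 1) z₁ z₂ *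
      (M.D π M.b * z₁ ^ M.b + M.dormantForm π (fun j => M.gTail j z₁) +
      ∑ n ∈ Finset.range M.a, (M.A π n + M.delta * M.Gam π n : ℝ) * z₁ ^ n * M.H n z₁ +
      ∑ n ∈ Finset.Ico M.a M.b, M.K n z₁ * (M.A π n + M.Gam π n + M.D π n : ℝ) * M.Qn n z₁ -
      ∑ n ∈ Finset.range M.b, (M.A π n + M.Gam π n : ℝ) * z₁ ^ n) := by
  have h1 : ∑ n ∈ Finset.range M.a,
      ((1 - M.delta : ℝ) * (∑ k ∈ Finset.range (n + 1), M.gamma π n k : ℝ) *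
        ∑ j ∈ Finset.Ico n M.a, (M.e j n : ℂ) *
          ((M.gc (M.b - j) : ℂ) * z₁ ^ M.b + M.gTail j z₁)) =
      M.dormantForm π (z₁ ^ M.b • (fun j => (M.gc (M.b - j) : ℂ)) + fun j => M.gTail j z₁) := by
    rw [dormantForm_apply]
    refine Finset.sum_congr rfl fun n hn => ?_
    rw [hΓ n (Finset.mem_range.1 hn)]
    congr 1
    refine Finset.sum_congr rfl fun j _ => ?_
    simp only [Pi.add_apply, Pi.smul_apply, smul_eq_mul]
    ring
  rw [map_add, map_smul, ← D_eq hΓ, smul_eq_mul] at h1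
  rw [numD, ← Finset.mul_sum, Finset.sum_sub_distrib, Finset.sum_add_distrib, h1,
    ← Finset.sum_range_add_sum_Ico _ M.a_le_b,
    Finset.sum_sub_distrib]
  have h3 : ∑ n ∈ Finset.Ico M.a M.b, ((M.A π n + M.Gam π n + M.D π n : ℝ) * M.K n z₁ *
        (M.F (n - M.a + 1) z₁ z₂ * M.den z₁
          + (M.chi n 0 + M.F (n - M.a + 1) z₁ 1) * M.F (M.b - M.a + 1) z₁ z₂ * M.K M.b z₁)) =
      (∑ i ∈ Finset.Ico M.a M.b, M.K i z₁ *
        (M.A π i + M.Gam π i + M.D π i : ℝ) * M.F (i - M.a + 1) z₁ z₂) * M.den z₁ +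
      M.K M.b z₁ * M.F (M.b - M.a + 1) z₁ z₂ * ∑ n ∈ Finset.Ico M.a M.b,
        M.K n z₁ * (M.A π n + M.Gam π n + M.D π n : ℝ) * M.Qn n z₁ := by
    rw [Finset.sum_mul, Finset.mul_sum, ← Finset.sum_add_distrib]
    refine Finset.sum_congr rfl fun n _ => ?_
    rw [Qn]
    ring
  have h4 : ∑ n ∈ Finset.Ico M.a M.b, M.F (M.b - M.a + 1) z₁ z₂ * M.K M.b z₁ *
        (M.A π n + M.Gam π n : ℝ) * z₁ ^ n = M.K M.b z₁ * M.F (M.b - M.a + 1) z₁ z₂ *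
      ∑ n ∈ Finset.Ico M.a M.b, (M.A π n + M.Gam π n : ℝ) * z₁ ^ n := by
    rw [Finset.mul_sum]
    refine Finset.sum_congr rfl fun n _ => by ring
  rw [h3, h4]
  ring

/-! ### Solving for the normalized generating functions. -/

section Normalized

variable {P Q : State → ℝ≥0∞}

/-- In this section `Q` is already divided by the completion probability. `hQ` expresses this on
completing states only; at dormant states `Q` is not a conditional probability. -/
theorem A_eq (h : M.IsStationary P Q)
    (hQ : ∀ s ∈ completing, M.completionLaw π s = (Q s).toReal) (n : ℕ) :
    M.A π n = (M.batchRate Q n).toReal := by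
  have h1 : ∀ r ∈ Finset.Icc M.a M.b, Q (.fes n r 1) * ENNReal.ofReal (M.chi r 0) ≠ ∞ :=
    fun r _ => ENNReal.mul_ne_top (h.ne_top' _) ENNReal.ofReal_ne_top
  have h2 : ∀ j ∈ Finset.Icc 1 M.b, Q (.sos n j 1) ≠ ∞ := fun j _ => h.ne_top' _
  rw [h.batchRate_eq, ENNReal.toReal_add (ENNReal.sum_ne_top.2 h1) (ENNReal.sum_ne_top.2 h2),
    ENNReal.toReal_sum h1, ENNReal.toReal_sum h2, A]
  congr 1
  · refine Finset.sum_congr rfl fun r _ => ?_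
    rw [ENNReal.toReal_mul, ENNReal.toReal_ofReal (M.chi_nonneg r 0), alpha, hQ _ rfl]
  · exact Finset.sum_congr rfl fun j _ => hQ _ rfl

theorem Gam_eq (h : M.IsStationary P Q)
    (hQ : ∀ s ∈ completing, M.completionLaw π s = (Q s).toReal) (n : ℕ) :
    M.Gam π n = (vacRate Q n).toReal := by
  rw [h.vacRate_eq, ENNReal.toReal_sum fun k _ => h.ne_top' _, Gam]
  exact Finset.sum_congr rfl fun k _ => hQ _ rfl

/-- Summing over k ≤ n or over k < a is the same, since only types satisfying both conditions carry
mass. -/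
theorem sum_gamma_eq (h : M.IsStationary P Q)
    (hQ : ∀ s ∈ completing, M.completionLaw π s = (Q s).toReal) (n : ℕ) :
    ∑ k ∈ Finset.range (n + 1), M.gamma π n k = M.Gam π n := by
  rw [Gam_eq h hQ, h.vacRate_eq', ENNReal.toReal_sum fun k _ => h.ne_top' _]
  exact Finset.sum_congr rfl fun k _ => hQ _ rfl

theorem dormant_toReal_eq (h : M.IsStationary P Q)
    (hQ : ∀ s ∈ completing, M.completionLaw π s = (Q s).toReal) {n : ℕ} (hn : M.a ≤ n) :
    (Q (.dormant n)).toReal = M.D π n := by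
  rw [h.dormant_arr_eq hn, D]
  simp only [← Finset.sum_mul, sum_gamma_eq h hQ, Gam_eq h hQ]

/-- Queue length b is separated because the tails in the numerators begin at i + j = b + 1. -/
theorem gf_dormant_tail (h : M.IsStationary P Q)
    (hQ : ∀ s ∈ completing, M.completionLaw π s = (Q s).toReal) {z : ℂ} (hz : ‖z‖ ≤ 1) :
    z ^ M.b * gf (fun n => Q (.dormant (n + M.b))) z =
      M.D π M.b * z ^ M.b + M.dormantForm π fun j => M.gTail j z := by
  have hab := M.a_le_b
  have hs : HasSum (fun n : ℕ => (M.D π (n + 1 + M.b) : ℂ) * z ^ (n + 1 + M.b))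
      (M.dormantForm π fun j => M.gTail j z) := by
    rw [dormantForm_apply]
    have := hasSum_sum (s := Finset.range M.a) fun n hn =>
      (hasSum_sum (s := Finset.Ico n M.a) fun j hj =>
        (hasSum_gTail (M := M) (j := j) (by rw [Finset.mem_Ico] at hj; omega) hz).mul_left
          (M.e j n : ℂ)).mul_left (((1 - M.delta : ℝ) : ℂ) * M.Gam π n)
    refine this.congr_fun fun n => ?_
    rw [D_eq (fun n _ => sum_gamma_eq h hQ n), dormantForm_apply, Finset.sum_mul]
    refine Finset.sum_congr rfl fun l _ => ?_
    rw [mul_assoc, Finset.sum_mul]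
    congr 1
    exact Finset.sum_congr rfl fun j _ => by ring
  have ht := tsum_nat_add_ne_top h.tsum_dormant_ne_top' M.b
  rw [gf, (summable_gf ht hz).tsum_eq_zero_add, mul_add, zero_add, pow_zero, mul_one,
    dormant_toReal_eq h hQ hab, mul_comm (z ^ M.b), ← tsum_mul_left, ← hs.tsum_eq]
  congr 1
  refine tsum_congr fun n => ?_
  rw [dormant_toReal_eq h hQ (by omega)]
  ring

/-- After an FES of size r the batch leaves at once with weight χ_{r,0}, or after an SOS of y
customers with weight χ_{r,y}T^y; these add up to Q_r. -/
theorem gf_batchRate (h : M.IsStationary P Q) {z : ℂ} (hz : ‖z‖ ≤ 1) :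
    gf (M.batchRate Q) z =
      ∑ r ∈ Finset.Icc M.a M.b, gf (fun n => Q (.fes n r 1)) z * M.Qn r z := by
  have e : M.batchRate Q = fun n =>
      ∑ r ∈ Finset.Icc M.a M.b, Q (.fes n r 1) * ENNReal.ofReal (M.chi r 0) +
      ∑ j ∈ Finset.Icc 1 M.b, Q (.sos n j 1) := by
    ext n
    exact h.batchRate_eq n
  rw [e, gf_add (IsStationary.tsum_sum_ne_top fun r _ => h.tsum_fes_mul_ne_top r 0)
    (IsStationary.tsum_sum_ne_top fun j _ => h.tsum_sos_ne_top' j 1) hz,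
    gf_sum _ (fun r _ => h.tsum_fes_mul_ne_top r 0) hz,
    gf_sum _ (fun j _ => h.tsum_sos_ne_top' j 1) hz,
    Finset.sum_congr rfl fun j hj => h.gf_sos (by rw [Finset.mem_Icc] at hj; omega) hz]
  simp only [Finset.mul_sum]
  rw [Finset.sum_comm, ← Finset.sum_add_distrib]
  refine Finset.sum_congr rfl fun r hr => ?_
  rw [gf_mul_const, ENNReal.toReal_ofReal (M.chi_nonneg r 0), Qn_eq hr, mul_add, Finset.mul_sum]
  congr 1
  exact Finset.sum_congr rfl fun j _ => by ring

theorem gf_vacRate (h : M.IsStationary P Q)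
    (hQ : ∀ s ∈ completing, M.completionLaw π s = (Q s).toReal) {z : ℂ} (hz : ‖z‖ ≤ 1) :
    gf (vacRate Q) z =
      ∑ n ∈ Finset.range M.a, (M.A π n + M.delta * M.Gam π n : ℝ) * z ^ n * M.H n z := by
  have e : vacRate Q = fun n => ∑ k ∈ Finset.range M.a, Q (.vac n k 1) := by
    ext n
    exact h.vacRate_eq n
  rw [e, gf_sum _ (fun k _ => h.tsum_vac_ne_top' k 1) hz]
  refine Finset.sum_congr rfl fun k hk => ?_
  rw [h.gf_vac (Finset.mem_range.1 hk) hz, A_eq h hQ, Gam_eq h hQ, mul_comm]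

/-- The generating function of the rate at which batches of maximal size start, times the common
denominator. -/
theorem gf_fesRate_mul_den (h : M.IsStationary P Q)
    (hQ : ∀ s ∈ completing, M.completionLaw π s = (Q s).toReal) {z : ℂ} (hz : ‖z‖ ≤ 1) :
    gf (fun n => M.fesRate Q n M.b) z * M.den z =
      M.D π M.b * z ^ M.b + M.dormantForm π (fun j => M.gTail j z) +
      ∑ n ∈ Finset.range M.a, (M.A π n + M.delta * M.Gam π n : ℝ) * z ^ n * M.H n z +
      ∑ n ∈ Finset.Ico M.a M.b, M.K n z * (M.A π n + M.Gam π n + M.D π n : ℝ) * M.Qn n z -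
      ∑ n ∈ Finset.range M.b, (M.A π n + M.Gam π n : ℝ) * z ^ n := by
  have hd := tsum_nat_add_ne_top h.tsum_dormant_ne_top' M.b
  have hB := tsum_nat_add_ne_top h.tsum_batchRate_ne_top M.b
  have hV := tsum_nat_add_ne_top h.tsum_vacRate_ne_top M.b
  have hY : gf (fun n => M.fesRate Q n M.b) z = gf (fun n => Q (.dormant (n + M.b))) z +
      gf (fun n => M.batchRate Q (n + M.b)) z + gf (fun n => vacRate Q (n + M.b)) z := by
    simp only [IsStationary.fesRate_b]
    rw [gf_add _ hV hz, gf_add hd hB hz]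
    rw [ENNReal.tsum_add]
    exact ENNReal.add_ne_top.2 ⟨hd, hB⟩
  have h1 := gf_eq_sum_add h.tsum_batchRate_ne_top hz M.b
  have h2 := gf_eq_sum_add h.tsum_vacRate_ne_top hz M.b
  rw [gf_batchRate h hz, sum_Icc_eq_sum_Ico_add M.a_le_b, h.gf_fes M.b hz] at h1
  rw [gf_vacRate h hQ hz] at h2
  have h3 : ∑ r ∈ Finset.Ico M.a M.b, gf (fun n => Q (.fes n r 1)) z * M.Qn r z =
      ∑ n ∈ Finset.Ico M.a M.b, M.K n z * (M.A π n + M.Gam π n + M.D π n : ℝ) * M.Qn n z := by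
    refine Finset.sum_congr rfl fun r hr => ?_
    rw [h.gf_fes_of_lt hr hz, dormant_toReal_eq h hQ (Finset.mem_Ico.1 hr).1, A_eq h hQ,
      Gam_eq h hQ]
    push_cast
    rfl
  have h4 : ∑ n ∈ Finset.range M.b, ((M.A π n + M.Gam π n : ℝ) : ℂ) * z ^ n =
      ∑ n ∈ Finset.range M.b, ((M.batchRate Q n).toReal : ℂ) * z ^ n +
      ∑ n ∈ Finset.range M.b, ((vacRate Q n).toReal : ℂ) * z ^ n := by
    rw [← Finset.sum_add_distrib]
    refine Finset.sum_congr rfl fun n _ => ?_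
    rw [A_eq h hQ, Gam_eq h hQ]
    push_cast
    ring
  rw [h3] at h1
  have h5 := gf_dormant_tail h hQ hz
  have h6 : M.den z = z ^ M.b - M.Qn M.b z * M.K M.b z := rfl
  rw [h4, h6]
  -- `h1` and `h2` remove the first b terms. The summand r = b in `h1` contains the unknown Y itself
  -- and supplies the second term of 𝒟.
  linear_combination z ^ M.b * hY + h5 - h1 - h2

theorem Pgf_term_eq (hQ : ∀ s ∈ completing, M.completionLaw π s = (Q s).toReal) (z₁ z₂ : ℂ) :
    (fun n : ℕ => ∑ r ∈ Finset.Icc M.a M.b, (M.alpha π n r : ℂ) * z₁ ^ n * z₂ ^ r) =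
    fun n => ∑ r ∈ Finset.Icc M.a M.b, ((Q (.fes n r 1)).toReal : ℂ) * z₁ ^ n * z₂ ^ r := by
  ext n
  exact Finset.sum_congr rfl fun r _ => by rw [alpha, hQ _ rfl]

theorem Dgf_term_eq (hQ : ∀ s ∈ completing, M.completionLaw π s = (Q s).toReal) (z₁ z₂ : ℂ) :
    (fun n : ℕ => ∑ y ∈ Finset.Icc 1 M.b, (M.beta π n y : ℂ) * z₁ ^ n * z₂ ^ y) =
    fun n => ∑ y ∈ Finset.Icc 1 M.b, ((Q (.sos n y 1)).toReal : ℂ) * z₁ ^ n * z₂ ^ y := by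
  ext n
  exact Finset.sum_congr rfl fun r _ => by rw [beta, hQ _ rfl]

theorem hasSum_Pgf (h : M.IsStationary P Q)
    (hQ : ∀ s ∈ completing, M.completionLaw π s = (Q s).toReal) {z₁ : ℂ} (hz : ‖z₁‖ ≤ 1)
    (z₂ : ℂ) : HasSum
      (fun n : ℕ => ∑ r ∈ Finset.Icc M.a M.b, (M.alpha π n r : ℂ) * z₁ ^ n * z₂ ^ r)
      (∑ r ∈ Finset.Icc M.a M.b, gf (fun n => Q (.fes n r 1)) z₁ * z₂ ^ r) := by
  rw [Pgf_term_eq hQ]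
  exact hasSum_sum fun r _ => ((summable_gf (h.tsum_fes_ne_top' r 1) hz).hasSum).mul_right _

theorem hasSum_Dgf (h : M.IsStationary P Q)
    (hQ : ∀ s ∈ completing, M.completionLaw π s = (Q s).toReal) {z₁ : ℂ} (hz : ‖z₁‖ ≤ 1)
    (z₂ : ℂ) : HasSum
      (fun n : ℕ => ∑ y ∈ Finset.Icc 1 M.b, (M.beta π n y : ℂ) * z₁ ^ n * z₂ ^ y)
      (∑ y ∈ Finset.Icc 1 M.b, gf (fun n => Q (.sos n y 1)) z₁ * z₂ ^ y) := by
  rw [Dgf_term_eq hQ]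
  exact hasSum_sum fun r _ => ((summable_gf (h.tsum_sos_ne_top' r 1) hz).hasSum).mul_right _

/-- The weight `f` is left free: z₂^r gives Π⁺ and F_{r-a+1}(z₁, z₂) gives Δ⁺. -/
theorem sum_gf_fes_mul (h : M.IsStationary P Q)
    (hQ : ∀ s ∈ completing, M.completionLaw π s = (Q s).toReal) {z : ℂ} (hz : ‖z‖ ≤ 1)
    (f : ℕ → ℂ) : (∑ r ∈ Finset.Icc M.a M.b, gf (fun n => Q (.fes n r 1)) z * f r) =
      ∑ i ∈ Finset.Ico M.a M.b, M.K i z * (M.A π i + M.Gam π i + M.D π i : ℝ) * f i +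
        M.K M.b z * f M.b * gf (fun n => M.fesRate Q n M.b) z := by
  rw [sum_Icc_eq_sum_Ico_add M.a_le_b, h.gf_fes M.b hz]
  congr 1
  · refine Finset.sum_congr rfl fun r hr => ?_
    rw [h.gf_fes_of_lt hr hz, dormant_toReal_eq h hQ (Finset.mem_Ico.1 hr).1, A_eq h hQ,
      Gam_eq h hQ]
    push_cast
    rfl
  · ring

theorem Pgf_mul_den (h : M.IsStationary P Q)
    (hQ : ∀ s ∈ completing, M.completionLaw π s = (Q s).toReal) {z₁ : ℂ} (hz : ‖z₁‖ ≤ 1)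
    (z₂ : ℂ) : M.Pgf π z₁ z₂ * M.den z₁ = M.numP π z₁ z₂ := by
  rw [Pgf, (hasSum_Pgf h hQ hz z₂).tsum_eq, sum_gf_fes_mul h hQ hz fun r => z₂ ^ r,
    numP_eq fun n _ => sum_gamma_eq h hQ n, ← gf_fesRate_mul_den h hQ hz]
  ring

theorem Dgf_mul_den (h : M.IsStationary P Q)
    (hQ : ∀ s ∈ completing, M.completionLaw π s = (Q s).toReal) {z₁ : ℂ} (hz : ‖z₁‖ ≤ 1)
    (z₂ : ℂ) : M.Dgf π z₁ z₂ * M.den z₁ = M.numD π z₁ z₂ := by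
  have e : (∑ y ∈ Finset.Icc 1 M.b, gf (fun n => Q (.sos n y 1)) z₁ * z₂ ^ y) =
      ∑ r ∈ Finset.Icc M.a M.b, gf (fun n => Q (.fes n r 1)) z₁ * M.F (r - M.a + 1) z₁ z₂ := by
    rw [Finset.sum_congr rfl fun y hy => by
        rw [h.gf_sos (by rw [Finset.mem_Icc] at hy; omega) hz, Finset.mul_sum, Finset.sum_mul],
      Finset.sum_comm]
    refine Finset.sum_congr rfl fun r hr => ?_
    rw [F_eq hr, Finset.mul_sum]
    exact Finset.sum_congr rfl fun y _ => by ring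
  rw [Dgf, (hasSum_Dgf h hQ hz z₂).tsum_eq, e,
    sum_gf_fes_mul h hQ hz fun r => M.F (r - M.a + 1) z₁ z₂,
    numD_eq fun n _ => sum_gamma_eq h hQ n, ← gf_fesRate_mul_den h hQ hz]
  ring

end Normalized

/-! ### Positivity of the completion probability, and the theorem. -/

theorem completionProb_pos {π : PMF State} (hπ : M.IsSteadyState π) :
    0 < M.completionProb π := by
  rw [pos_iff_ne_zero]
  intro h0
  have h1 := (M.isStationary_of_isSteadyState hπ).eq_zero_of_completing fun s hs => by
    have := ENNReal.tsum_eq_zero.1 h0 s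
    rwa [Set.indicator_of_mem hs] at this
  rw [π.tsum_coe] at h1
  exact one_ne_zero h1

end Model
end GeoQueue

theorem mainTheorem1 (M : GeoQueue.Model) (π : PMF GeoQueue.State) (hπ : M.IsSteadyState π) :
    0 < M.completionProb π ∧
    ∀ z₁ z₂ : ℂ, ‖z₁‖ ≤ 1 → ‖z₂‖ ≤ 1 →
      (Summable fun n : ℕ =>
        ∑ r ∈ Finset.Icc M.a M.b, (M.alpha π n r : ℂ) * z₁ ^ n * z₂ ^ r) ∧
      (Summable fun n : ℕ =>
        ∑ y ∈ Finset.Icc 1 M.b, (M.beta π n y : ℂ) * z₁ ^ n * z₂ ^ y) ∧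
      M.Pgf π z₁ z₂ * M.den z₁ = M.numP π z₁ z₂ ∧
      M.Dgf π z₁ z₂ * M.den z₁ = M.numD π z₁ z₂ ∧
      (M.den z₁ ≠ 0 →
        M.Pgf π z₁ z₂ = M.numP π z₁ z₂ / M.den z₁ ∧
        M.Dgf π z₁ z₂ = M.numD π z₁ z₂ / M.den z₁) := by
  have hpos := GeoQueue.Model.completionProb_pos hπ
  -- Positivity makes the scaling factor finite, so the scaled pair remains stationary.
  have h := (M.isStationary_of_isSteadyState hπ).const_mul (ENNReal.inv_ne_top.2 hpos.ne')
  have hQ : ∀ s ∈ GeoQueue.completing, M.completionLaw π s =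
      ((M.completionProb π)⁻¹ * M.arrivals π s).toReal := fun s hs => by
    rw [GeoQueue.Model.completionLaw, Set.indicator_of_mem hs, div_eq_mul_inv, mul_comm]
  refine ⟨hpos, fun z₁ z₂ hz _ => ?_⟩
  have hP := GeoQueue.Model.Pgf_mul_den h hQ hz z₂
  have hD := GeoQueue.Model.Dgf_mul_den h hQ hz z₂
  exact ⟨(GeoQueue.Model.hasSum_Pgf h hQ hz z₂).summable,
    (GeoQueue.Model.hasSum_Dgf h hQ hz z₂).summable, hP, hD,
    fun hden => ⟨(eq_div_iff hden).2 hP, (eq_div_iff hden).2 hD⟩⟩
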